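/- **Setting.** Let $\mathcal Y=\{1,\dots,K\}$ be the set of classes and let $1\le I\le K-1$. Let $P$ be a probability law of a pair $(X,Y)\in\mathcal X\times\mathcal Y$. In *is-in-type Q&A labeling* with $I$ question items, a question set $Q$ is drawn uniformly among the $I$-element subsets of $\mathcal Y$, independently of $(X,Y)$, and the label of the instance is $\widetilde Y=Q$ if $Y\in Q$ and $\widetilde Y=\mathcal Y\setminus Q$ otherwise. Let $\widetilde P_I$ be the law of $(X,\widetilde Y)$. Let $\mathcal F$ be a class of measurable functions $f=(g_1,\dots,g_K):\mathcal X\to\mathbb R^K$, and let $\mathcal G_y=\{f_y: f\in\mathcal F\}$ be the class of its $y$-th components. (As usual, the suprema over these classes and over the loss class whose expectations are considered are assumed to be measurable.) Let $\mathcal L(v,y)\ge 0$ be a loss on $\mathbb R^K\times\mathcal Y$ with $C_L=\sup_{x\in\mathcal X,\,f\in\mathcal F,\,y\in\mathcal Y}\mathcal L(f(x),y)<\infty$, and let $$R(f)=\mathbb E_P[\mathcal L(f(X),Y)],\qquad \widetilde{\mathcal L}_I(v,\tilde y)=\sum_{y\in\tilde y}\mathcal L(v,y)-\frac{2I^2+K^2-K(2I+1)}{2I(K-I)}\sum_{y\notin\tilde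 y}\mathcal L(v,y).$$ Suppose that, on the set of attained values $f(x)$, every $\widetilde{\mathcal L}_I(\cdot,\tilde y)$ with $|\tilde y|\in\{I,K-I\}$ is $\rho$-Lipschitz for the Euclidean norm. Let $f^*\in\mathcal F$ minimize $R$ over $\mathcal F$. For an i.i.d. sample $(x_i,\tilde y_i)_{i=1}^n$ from $\widetilde P_I$, $n\ge1$, let $\hat f$ be any minimizer over $\mathcal F$ of $\widehat R(f)=\frac1n\sum_{i=1}^n\widetilde{\mathcal L}_I(f(x_i),\tilde y_i)$. Let $$\mathfrak R_n(\mathcal G)=\mathbb E_{x_1,\dots,x_n}\mathbb E_\sigma\Big[\sup_{g\in\mathcal G}\frac1n\sum_{i=1}^n\sigma_i g(x_i)\Big]\in[0,\infty]$$ be the Rademacher complexity, where $x_1,\dots,x_n$ are i.i.d. with the law of $X$ and $\sigma_1,\dots,\sigma_n$ are independent and uniform on $\{-1,+1\}$. **Theorem.** 1. For every $n\ge1$ and $\delta>0$, with probability greater than $1-\delta$, $$R(\hat f)-R(f^*)\le\frac{\sqrt2\,\rho K^2(K-1)}{I(K-I)}\sum_{y\in\mathcal Y}\mathfrak R_n(\mathcal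 G_y)+\frac{K(K-1)}{2\min(I,K-I)}\,C_L\sqrt{\frac{2\log(2/\delta)}{n}}$$ for every minimizer $\hat f$ of $\widehat R$ (for $\delta>2$ the square root is read as $0$). 2. With $n$, $\delta$, $\rho$, $C_L$ and the $\mathfrak R_n(\mathcal G_y)$ held fixed, the right-hand side, as a function of a real number $I\in(0,K)$, attains its minimum at $I=K/2$. 3. Learning is consistent: if $\mathfrak R_n(\mathcal G_y)\to0$ as $n\to\infty$ for every $y$, then $R(\hat f)\to R(f^*)$ in probability. In particular, this convergence holds for the linear-in-parameter model, in which $\mathcal F$ consists of all $f$ whose components are $f_y(x)=\langle w_y,\Phi(x)\rangle_{\mathbb H}$ with $\|w_y\|_{\mathbb H}\le\Lambda$, where $\Lambda\ge0$ and $\Phi:\mathcal X\to\mathbb H$ is a feature map into a Hilbert space with $\sup_x\langle\Phi(x),\Phi(x)\rangle_{\mathbb H}<\infty$. -/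

import Mathlib

open MeasureTheory ProbabilityTheory Filter Topology
open scoped ENNReal NNReal

universe u v

noncomputable section

namespace QALabel

/-- The score space `ℝ^K` with its Euclidean norm: a hypothesis `f : X → Score K` has the
discriminant functions `g_y = fun x => f x y` as its components. -/
abbrev Score (K : ℕ) : Type := EuclideanSpace ℝ (Fin K)

/-- The label produced by an is-in-type question with question class set `q`, when the class of
the instance is `z`: `q` if the answer is "yes", the complement of `q` if it is "no". -/
def isInLabel {K : ℕ} (z : Fin K) (q : Finset (Fin K)) : Finset (Fin K) :=
  if z ∈ q then q else qᶜ

/-- The joint law of (instance, is-in-type label): the pair (instance, class) is drawn from `P`,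
the question class set is drawn, independently, uniformly among the `I`-element sets of classes. -/
def isInLaw {X : Type u} [MeasurableSpace X] {K : ℕ} (P : Measure (X × Fin K)) (I : ℕ) :
    Measure (X × Finset (Fin K)) :=
  (P.prod (uniformOn {q : Finset (Fin K) | q.card = I})).map
    (fun w => (w.1.1, isInLabel w.1.2 w.2))

/-- The law of `n` independent samples from `μ`. -/
def sampleLaw {Z : Type u} [MeasurableSpace Z] (μ : Measure Z) (n : ℕ) : Measure (Fin n → Z) :=
  Measure.pi (fun _ => μ)

/-- The loss for is-in-type labels (`I` question items) that is built from the ordinary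
loss `L`. -/
def isInLoss {K : ℕ} (L : Score K → Fin K → ℝ) (I : ℕ) (v : Score K) (s : Finset (Fin K)) : ℝ :=
  ∑ y ∈ s, L v y -
    (2 * (I : ℝ) ^ 2 + (K : ℝ) ^ 2 - K * (2 * I + 1)) / (2 * I * (K - I)) * ∑ y ∈ sᶜ, L v y

/-- The classification risk `R(f) = E_{P(X,Y)} L(f(X), Y)`. -/
def risk {X : Type u} [MeasurableSpace X] {K : ℕ} (P : Measure (X × Fin K))
    (L : Score K → Fin K → ℝ) (f : X → Score K) : ℝ :=
  ∫ p, L (f p.1) p.2 ∂P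

/-- The empirical risk of `f` on a sample with is-in-type labels. -/
def empRisk {X : Type u} {K n : ℕ} (L : Score K → Fin K → ℝ) (I : ℕ)
    (S : Fin n → X × Finset (Fin K)) (f : X → Score K) : ℝ :=
  (1 / (n : ℝ)) * ∑ i, isInLoss L I (f (S i).1) (S i).2

/-- `f` minimizes the empirical risk over `F`. -/
def IsERM {X : Type u} {K n : ℕ} (L : Score K → Fin K → ℝ) (I : ℕ) (F : Set (X → Score K))
    (S : Fin n → X × Finset (Fin K)) (f : X → Score K) : Prop :=
  f ∈ F ∧ IsMinOn (empRisk L I S) F f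

/-- The score vectors that the hypotheses in `F` attain. -/
def attained {X : Type u} {K : ℕ} (F : Set (X → Score K)) : Set (Score K) :=
  {v | ∃ f ∈ F, ∃ x, v = f x}

/-- The class `𝒢_y` of discriminant functions for the class `y`. -/
def discClass {X : Type u} {K : ℕ} (F : Set (X → Score K)) (y : Fin K) : Set (X → ℝ) :=
  {g | ∃ f ∈ F, g = fun x => f x y}

/-- The loss class: all functions `(x, s) ↦ isInLoss L I (f x) s` with `f ∈ F`. -/
def lossClass {X : Type u} {K : ℕ} (L : Score K → Fin K → ℝ) (I : ℕ) (F : Set (X → Score K)) :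
    Set (X × Finset (Fin K) → ℝ) :=
  {h | ∃ f ∈ F, h = fun z => isInLoss L I (f z.1) z.2}

/-- The value `±1` of a Rademacher variable. -/
def sgn (b : Bool) : ℝ := if b then 1 else -1

/-- The Rademacher complexity of a nonempty class `H` of real functions, for `n` independent
points with law `μ`. The suprema are taken in the extended reals, so that an infinite complexity
has the value `∞`. The sum over all sign patterns is nonnegative, since each `h ∈ H`
contributes `0` to it in total; hence `toENNReal` changes nothing. -/
def rademacher {Z : Type u} [MeasurableSpace Z] (μ : Measure Z) (n : ℕ) (H : Set (Z → ℝ)) :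
    ℝ≥0∞ :=
  ∫⁻ z, (∑ σ : Fin n → Bool, ⨆ h ∈ H,
      (((1 / (n : ℝ)) * ∑ i, sgn (σ i) * h (z i) : ℝ) : EReal)).toENNReal / 2 ^ n
    ∂(sampleLaw μ n)

/-- The class `H` is measurable: the suprema over `H` of weighted sums, which are the random
variables whose expectations are considered, are measurable functions of the sample. -/
def MeasurableClass {Z : Type u} [MeasurableSpace Z] (H : Set (Z → ℝ)) : Prop :=
  ∀ (n : ℕ) (a : Fin n → ℝ),
    Measurable fun z : Fin n → Z => ⨆ h ∈ H, ((∑ i, a i * h (z i) : ℝ) : EReal)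

/-- The upper bound for the excess risk, as a function of a real number `t` of question items.
`ρ` is a Lipschitz constant, `rad` the sum of the Rademacher complexities of the `𝒢_y`, and `C`
the largest value of the loss. -/
def excessBound (K : ℕ) (ρ : ℝ≥0) (C : ℝ) (rad : ℝ≥0∞) (n : ℕ) (δ t : ℝ) : ℝ≥0∞ :=
  ENNReal.ofReal (√2 * ρ * (K : ℝ) ^ 2 * (K - 1) / (t * (K - t))) * rad +
    ENNReal.ofReal
      (K * (K - 1) / (2 * min t (K - t)) * C * √(2 * Real.log (2 / δ) / n))

/-- The linear-in-parameter model with feature map `Φ` into a Hilbert space: every discriminant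
function is `x ↦ ⟪w, Φ x⟫` with `‖w‖ ≤ Λ`. -/
def kernelModel {X : Type u} {H : Type v} [NormedAddCommGroup H] [InnerProductSpace ℝ H]
    (K : ℕ) (Φ : X → H) (Λ : ℝ) : Set (X → Score K) :=
  {f | ∀ y, ∃ w : H, ‖w‖ ≤ Λ ∧ ∀ x, f x y = inner ℝ w (Φ x)}

/-- Consistency of empirical risk minimization from is-in-type labels: the excess risk, relative
to `fstar`, of the empirical risk minimizers tends to `0` in (outer) probability. -/
def Consistent {X : Type u} [MeasurableSpace X] {K : ℕ} (P : Measure (X × Fin K))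
    (L : Score K → Fin K → ℝ) (I : ℕ) (F : Set (X → Score K)) (fstar : X → Score K) : Prop :=
  ∀ ε : ℝ, 0 < ε →
    Tendsto (fun n : ℕ => sampleLaw (isInLaw P I) n
      {S | ∃ fhat, IsERM L I F S fhat ∧ ε < risk P L fhat - risk P L fstar}) atTop (𝓝 0)

end QALabel

end

/-! The label loss is an unbiased estimate of the ordinary loss. A class `y` other than the true one
is missing from the label with probability `2I(K-I)/(K(K-1))`, and the weight in `isInLoss` is the
reciprocal of this number minus one. Averaging over the questions therefore cancels every wrong
class and leaves `L v z` (`sum_isInLoss_isInLabel`, `integral_isInLoss`), so `risk` is the mean of a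
function in the loss class and the theory of empirical risk minimization applies.

For a minimizer, the excess risk is at most the largest one-sided deviation of means from sample
averages over the loss class, plus the deviation of the single function of `fstar` in the other
direction. McDiarmid's inequality is applied once, to the sum of these two quantities
(`measure_exists_excess_le`). Symmetrization with a ghost sample bounds the mean of the first by
twice the Rademacher average of the loss class (`integral_ghostSup_le`); the second is centred. The
choice of deviation makes the tail `δ/2`, which gives the strict inequality.

A vector contraction inequality (`expect_iSup_le_sum_expect_iSup`) passes from the loss class to the
component classes at the price of a factor `ρK`. It replaces each sign by `K` independent signs and
needs only elementary averaging; `2ρK` is still below the stated coefficient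
(`two_mul_le_coefficient`).

The optimum at `K/2` holds because `t(K-t)` and `min t (K-t)` are both largest there. Consistency
follows by fixing `δ` and letting `n` grow; for the linear model, Cauchy–Schwarz and orthogonality
of signs bound the complexities by a multiple of `1/√n`. -/

open scoped BigOperators

namespace QALabel

/-! ### Vector contraction for Rademacher averages -/

section Contraction

lemma sgn_not (b : Bool) : sgn (!b) = -sgn b := by cases b <;> simp [sgn]

/-- Pair each sign pattern with the one that flips every sign except that of `j`. The two sums add
up to `±2 d j`, so their absolute values average to at least `|d j|`. -/
lemma abs_le_expect_abs_sum_sgn {ι : Type*} [Fintype ι] [DecidableEq ι] (d : ι → ℝ) (j : ι) :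
    |d j| ≤ 𝔼 τ : ι → Bool, |∑ y, sgn (τ y) * d y| := by
  have hinv : Function.Involutive
      (fun (τ : ι → Bool) (y : ι) => if y = j then τ y else !τ y) := by
    intro τ; ext y; by_cases h : y = j <;> simp [h]
  have h1 : 𝔼 τ : ι → Bool, |∑ y, sgn (hinv.toPerm _ τ y) * d y| =
      𝔼 τ : ι → Bool, |∑ y, sgn (τ y) * d y| :=
    Fintype.expect_equiv (hinv.toPerm _) _ _ (fun _ => rfl)
  have h2 : ∀ τ : ι → Bool, 2 * |d j| ≤
      |∑ y, sgn (τ y) * d y| + |∑ y, sgn (hinv.toPerm _ τ y) * d y| := by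
    intro τ
    refine le_trans (le_of_eq ?_) (abs_add_le _ _)
    rw [← Finset.sum_add_distrib, Finset.sum_eq_single j]
    · simp only [Function.Involutive.coe_toPerm, if_true]
      cases τ j <;> simp [sgn, ← two_mul, abs_mul]
    · intro y _ hy
      simp only [Function.Involutive.coe_toPerm, if_neg hy, sgn_not]
      ring
    · simp
  have h3 : 2 * |d j| ≤ 𝔼 τ : ι → Bool,
      (|∑ y, sgn (τ y) * d y| + |∑ y, sgn (hinv.toPerm _ τ y) * d y|) :=
    Finset.le_expect Finset.univ_nonempty (fun τ _ => h2 τ)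
  rw [Finset.expect_add_distrib, h1] at h3
  linarith

lemma sum_abs_le_card_mul_expect {ι : Type*} [Fintype ι] [DecidableEq ι] (d : ι → ℝ) :
    ∑ y, |d y| ≤ Fintype.card ι * 𝔼 τ : ι → Bool, |∑ y, sgn (τ y) * d y| := by
  refine (Finset.sum_le_card_nsmul _ _ _ fun y _ => abs_le_expect_abs_sum_sgn d y).trans ?_
  simp [Finset.card_univ]

lemma expect_sgn_neg {ι : Type*} [Fintype ι] [DecidableEq ι] (Ψ : (ι → ℝ) → ℝ) :
    𝔼 τ : ι → Bool, Ψ (fun y => -sgn (τ y)) = 𝔼 τ : ι → Bool, Ψ (fun y => sgn (τ y)) := by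
  have hinv : Function.Involutive (fun (τ : ι → Bool) (y : ι) => !τ y) := by
    intro τ; ext y; simp
  refine Fintype.expect_equiv (hinv.toPerm _) _ _ fun τ => ?_
  simp [sgn_not]

variable {α : Type*} [Finite α] [Nonempty α] {ι : Type*} [Fintype ι] [DecidableEq ι]

/-- This exchanges a single sign, that of `h`, for one sign per coordinate of `g`. The offset `A`
stands for the terms of all other sample points. -/
lemma iSup_add_iSup_sub_le (A h : α → ℝ) (g : α → ι → ℝ) {c : ℝ} (hc : 0 ≤ c)
    (hlip : ∀ a b, |h a - h b| ≤ c * ∑ y, |g a y - g b y|) :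
    (⨆ a, (A a + h a)) + (⨆ a, (A a - h a)) ≤
      2 * 𝔼 τ : ι → Bool, ⨆ a, (A a + c * Fintype.card ι * ∑ y, sgn (τ y) * g a y) := by
  obtain ⟨a, ha⟩ := exists_eq_ciSup_of_finite (f := fun a => A a + h a)
  obtain ⟨b, hb⟩ := exists_eq_ciSup_of_finite (f := fun a => A a - h a)
  rw [← ha, ← hb]
  set k : ℝ := c * Fintype.card ι with hk
  have hk0 : 0 ≤ k := by positivity
  set T : (ι → Bool) → α → ℝ := fun τ a => ∑ y, sgn (τ y) * g a y with hT
  have hbdd : ∀ u : α → ℝ, BddAbove (Set.range u) := fun u => Set.Finite.bddAbove (Set.finite_range u)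
  have h1 : h a - h b ≤ 𝔼 τ : ι → Bool, k * |T τ a - T τ b| := by
    refine (le_abs_self _).trans ((hlip a b).trans ?_)
    rw [← Finset.mul_expect, hk, mul_assoc]
    refine mul_le_mul_of_nonneg_left ?_ hc
    refine (sum_abs_le_card_mul_expect fun y => g a y - g b y).trans (le_of_eq ?_)
    congr 1
    refine Finset.expect_congr rfl fun τ _ => ?_
    simp only [hT, ← Finset.sum_sub_distrib, mul_sub]
  have h2 : A a + A b + 𝔼 τ : ι → Bool, k * |T τ a - T τ b| ≤
      𝔼 τ : ι → Bool, ((⨆ a, (A a + k * T τ a)) + ⨆ a, (A a - k * T τ a)) := by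
    have : A a + A b = 𝔼 τ : ι → Bool, (A a + A b) := by simp
    rw [this, ← Finset.expect_add_distrib]
    refine Finset.expect_le_expect fun τ _ => ?_
    have p1 := fun a => le_ciSup (hbdd fun a => A a + k * T τ a) a
    have p2 := fun a => le_ciSup (hbdd fun a => A a - k * T τ a) a
    -- The sign of the difference decides which of the two maximizers is used in which supremum; the
    -- bound is the same either way.
    rcases abs_cases (T τ a - T τ b) with ⟨e, _⟩ | ⟨e, _⟩
    · rw [e]; linarith [p1 a, p2 b]
    · rw [e]; linarith [p1 b, p2 a]
  have h3 : 𝔼 τ : ι → Bool, (⨆ a, (A a - k * T τ a)) = 𝔼 τ : ι → Bool, ⨆ a, (A a + k * T τ a) := by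
    rw [← expect_sgn_neg (fun s => ⨆ a, (A a + k * ∑ y, s y * g a y))]
    refine Finset.expect_congr rfl fun τ _ => ?_
    simp [hT, sub_eq_add_neg]
  rw [Finset.expect_add_distrib, h3] at h2
  linarith

lemma expect_cons {β : Type*} [Fintype β] {n : ℕ} (Ψ : (Fin (n + 1) → β) → ℝ) :
    𝔼 σ : Fin (n + 1) → β, Ψ σ = 𝔼 b : β, 𝔼 σ : Fin n → β, Ψ (Fin.cons b σ) := by
  rw [← Finset.expect_product', Finset.univ_product_univ]
  exact (Fintype.expect_equiv (Fin.consEquiv fun _ => β) _ _ (fun _ => rfl)).symm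

/-- Induction on the sample points: with the sign of point `0` frozen into the offset, the other
points are handled by induction; then, with their signs frozen, point `0` is exchanged. This is why
`A` is arbitrary. -/
lemma expect_iSup_sum_le {n : ℕ} (A : α → ℝ) (h : Fin n → α → ℝ) (g : Fin n → α → ι → ℝ) {c : ℝ}
    (hc : 0 ≤ c) (hlip : ∀ i a b, |h i a - h i b| ≤ c * ∑ y, |g i a y - g i b y|) :
    𝔼 σ : Fin n → Bool, ⨆ a, (A a + ∑ i, sgn (σ i) * h i a) ≤
      𝔼 τ : Fin n → ι → Bool,
        ⨆ a, (A a + c * Fintype.card ι * ∑ i, ∑ y, sgn (τ i y) * g i a y) := by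
  induction n generalizing A with
  | zero => simp
  | succ n ih =>
    rw [expect_cons, expect_cons (β := ι → Bool)]
    simp only [Fin.sum_univ_succ, Fin.cons_zero, Fin.cons_succ]
    have h1 : ∀ b : Bool, 𝔼 σ : Fin n → Bool,
        (⨆ a, (A a + (sgn b * h 0 a + ∑ i : Fin n, sgn (σ i) * h i.succ a))) ≤
        𝔼 τ : Fin n → ι → Bool, ⨆ a, (A a + sgn b * h 0 a +
          c * Fintype.card ι * ∑ i : Fin n, ∑ y, sgn (τ i y) * g i.succ a y) := by
      intro b
      have := ih (fun a => A a + sgn b * h 0 a) (fun i => h i.succ) (fun i => g i.succ)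
        (fun i => hlip i.succ)
      simpa only [add_assoc] using this
    refine (Finset.expect_le_expect fun b _ => h1 b).trans ?_
    rw [Finset.expect_comm]
    rw [Finset.expect_comm (s := (Finset.univ : Finset (ι → Bool)))]
    refine Finset.expect_le_expect fun τ _ => ?_
    have := iSup_add_iSup_sub_le
      (fun a => A a + c * Fintype.card ι * ∑ i : Fin n, ∑ y, sgn (τ i y) * g i.succ a y)
      (h 0) (g 0) hc (hlip 0)
    have e : ∀ Ψ : Bool → ℝ, 𝔼 b, Ψ b = (Ψ true + Ψ false) / 2 := by
      intro Ψ; rw [Fintype.expect_eq_sum_div_card]; simp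
    rw [e]
    rw [div_le_iff₀' two_pos]
    refine (le_of_eq ?_).trans (this.trans (le_of_eq ?_))
    · congr 1 <;> · congr 1; ext a; simp [sgn]; ring
    · congr 1
      refine Finset.expect_congr rfl fun σ _ => ?_
      congr 1; ext a; ring

lemma expect_marginal {β : Type*} [Fintype β] [Nonempty β] {n : ℕ} (y : ι)
    (Ψ : (Fin n → β) → ℝ) :
    𝔼 τ : Fin n → ι → β, Ψ (fun i => τ i y) = 𝔼 σ : Fin n → β, Ψ σ := by
  classical
  let e : (Fin n → ι → β) ≃ (Fin n → β) × ({j // j ≠ y} → Fin n → β) :=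
    (Equiv.piComm fun _ _ => β).trans (Equiv.funSplitAt y (Fin n → β))
  rw [Fintype.expect_equiv e (fun τ => Ψ fun i => τ i y) (fun p => Ψ p.1) (fun τ => rfl), ← Finset.univ_product_univ,
    Finset.expect_product]
  simp

/-- A vector contraction inequality for Rademacher averages of a finite class. -/
theorem expect_iSup_le_sum_expect_iSup {n : ℕ} (h : Fin n → α → ℝ) (g : Fin n → α → ι → ℝ) {c : ℝ}
    (hc : 0 ≤ c) (hlip : ∀ i a b, |h i a - h i b| ≤ c * ∑ y, |g i a y - g i b y|) :
    𝔼 σ : Fin n → Bool, ⨆ a, (∑ i, sgn (σ i) * h i a) ≤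
      c * Fintype.card ι *
        ∑ y, 𝔼 σ : Fin n → Bool, ⨆ a, (∑ i, sgn (σ i) * g i a y) := by
  have h0 := expect_iSup_sum_le (fun _ => 0) h g hc hlip
  simp only [zero_add] at h0
  refine h0.trans ?_
  have hk0 : 0 ≤ c * Fintype.card ι := by positivity
  have hbdd : ∀ u : α → ℝ, BddAbove (Set.range u) := fun u => Set.Finite.bddAbove (Set.finite_range u)
  -- The supremum is subadditive over coordinates, and by `expect_marginal` each coordinate sees
  -- uniform signs of its own.
  have h1 : ∀ τ : Fin n → ι → Bool,
      (⨆ a, (c * Fintype.card ι * ∑ i, ∑ y, sgn (τ i y) * g i a y)) ≤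
      c * Fintype.card ι * ∑ y, ⨆ a, ∑ i, sgn (τ i y) * g i a y := by
    intro τ
    refine ciSup_le fun a => mul_le_mul_of_nonneg_left ?_ hk0
    rw [Finset.sum_comm]
    exact Finset.sum_le_sum fun y _ => le_ciSup (hbdd fun a => ∑ i, sgn (τ i y) * g i a y) a
  refine (Finset.expect_le_expect fun τ _ => h1 τ).trans (le_of_eq ?_)
  rw [← Finset.mul_expect, Finset.expect_sum_comm]
  congr 1
  refine Finset.sum_congr rfl fun y _ => ?_
  exact expect_marginal y (fun σ : Fin n → Bool => ⨆ a, ∑ i, sgn (σ i) * g i a y)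

end Contraction

/-! ### Bounded differences and McDiarmid's inequality -/

section McDiarmid

variable {Z : Type*} [MeasurableSpace Z]

lemma measurePreserving_cons (μ : Measure Z) [IsProbabilityMeasure μ] (n : ℕ) :
    MeasurePreserving (fun p : Z × (Fin n → Z) => (Fin.cons p.1 p.2 : Fin (n + 1) → Z))
      (μ.prod (Measure.pi fun _ => μ)) (Measure.pi fun _ => μ) := by
  have := (measurePreserving_piFinSuccAbove (fun _ : Fin (n + 1) => μ) 0).symm
  convert this using 1
  ext p i
  simp [MeasurableEquiv.piFinSuccAbove, Fin.insertNthEquiv]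

lemma ae_pi_mem {μ : Measure Z} [IsProbabilityMeasure μ] {G : Set Z} (hG : ∀ᵐ z ∂μ, z ∈ G) (n : ℕ) :
    ∀ᵐ S ∂(Measure.pi fun _ : Fin n => μ), ∀ i, S i ∈ G :=
  eventually_all.2 fun i =>
    (measurePreserving_eval (fun _ : Fin n => μ) i).quasiMeasurePreserving.ae hG

-- Coordinates are replaced one at a time. This makes `φ` bounded on samples from `G`, which
-- supplies all integrability below.
omit [MeasurableSpace Z] in
lemma abs_sub_le_of_bounded_differences {G : Set Z} {c : ℝ} {n : ℕ} {φ : (Fin n → Z) → ℝ}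
    (hd : ∀ S : Fin n → Z, (∀ i, S i ∈ G) → ∀ i, ∀ z ∈ G, |φ (Function.update S i z) - φ S| ≤ c)
    {S T : Fin n → Z} (hS : ∀ i, S i ∈ G) (hT : ∀ i, T i ∈ G) : |φ S - φ T| ≤ n * c := by
  induction n with
  | zero => simp [Subsingleton.elim S T]
  | succ n ih =>
    have h1 := hd T hT 0 (S 0) (hS 0)
    have h2 := ih (φ := fun S' => φ (Fin.cons (S 0) S')) (fun U hU i z hz => by
        have := hd (Fin.cons (S 0) U) (Fin.cases (hS 0) hU) i.succ z hz
        rwa [Fin.cons_update]) (S := Fin.tail S) (T := Fin.tail T)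
        (fun i => hS i.succ) (fun i => hT i.succ)
    rw [← Fin.cons_self_tail T, Fin.update_cons_zero] at h1
    simp only [Fin.cons_self_tail] at h1 h2
    have := abs_sub_le (φ S) (φ (Fin.cons (S 0) (Fin.tail T))) (φ T)
    push_cast
    linarith

/-- McDiarmid's inequality, in the form of a sub-Gaussian moment generating function. -/
theorem hasSubgaussianMGF_of_bounded_differences (μ : Measure Z) [IsProbabilityMeasure μ]
    {G : Set Z} (hG : ∀ᵐ z ∂μ, z ∈ G) (c : ℝ≥0) {n : ℕ} {φ : (Fin n → Z) → ℝ}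
    (hφ : Measurable φ)
    (hd : ∀ S : Fin n → Z, (∀ i, S i ∈ G) → ∀ i, ∀ z ∈ G, |φ (Function.update S i z) - φ S| ≤ c) :
    HasSubgaussianMGF (fun S => φ S - ∫ T, φ T ∂(Measure.pi fun _ => μ)) (n * (c / 2) ^ 2)
      (Measure.pi fun _ => μ) := by
  induction n with
  | zero =>
    have : (fun S => φ S - ∫ T, φ T ∂(Measure.pi fun _ : Fin 0 => μ)) = fun _ => 0 := by
      ext S
      have h : φ = fun _ => φ S := by ext T; rw [Subsingleton.elim T S]
      rw [h]; simp
    rw [this]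
    simp
  | succ n ih =>
    set ν : Measure (Fin n → Z) := Measure.pi fun _ => μ with hν
    set π : Measure (Fin (n + 1) → Z) := Measure.pi fun _ => μ with hπ
    have hmp : MeasurePreserving (fun p : Z × (Fin n → Z) => (Fin.cons p.1 p.2 : Fin (n + 1) → Z))
        (μ.prod ν) π := measurePreserving_cons μ n
    obtain ⟨z₀, hz₀⟩ := hG.exists
    set Φ : Z × (Fin n → Z) → ℝ := fun p => φ (Fin.cons p.1 p.2) with hΦdef
    have hΦ : Measurable Φ := hφ.comp hmp.measurable
    have hGn := ae_pi_mem hG n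
    have hGp : ∀ᵐ p ∂(μ.prod ν), p.1 ∈ G ∧ ∀ i, p.2 i ∈ G :=
      (Measure.quasiMeasurePreserving_fst.ae hG).and (Measure.quasiMeasurePreserving_snd.ae hGn)
    have hcons : ∀ z ∈ G, ∀ T : Fin n → Z, (∀ i, T i ∈ G) →
        ∀ i, (Fin.cons z T : Fin (n + 1) → Z) i ∈ G :=
      fun z hz T hT => Fin.cases hz hT
    set b₀ : ℝ := |φ (fun _ => z₀)| + (n + 1 : ℕ) * c with hb₀
    have hbound : ∀ z ∈ G, ∀ T : Fin n → Z, (∀ i, T i ∈ G) → |Φ (z, T)| ≤ b₀ := by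
      intro z hz T hT
      have h1 := abs_sub_le_of_bounded_differences hd (hcons z hz T hT) (fun _ => hz₀)
      have h2 := abs_sub_abs_le_abs_sub (Φ (z, T)) (φ fun _ => z₀)
      simp only [hΦdef] at *
      linarith
    have hΦint : Integrable Φ (μ.prod ν) :=
      Integrable.of_bound hΦ.aestronglyMeasurable b₀ (hGp.mono fun p hp => hbound p.1 hp.1 p.2 hp.2)
    have hint_z : ∀ z ∈ G, Integrable (fun T => Φ (z, T)) ν := fun z hz =>
      Integrable.of_bound (hΦ.comp measurable_prodMk_left).aestronglyMeasurable b₀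
        (hGn.mono fun T hT => hbound z hz T hT)
    -- `ψ` is the conditional mean given the first coordinate. It oscillates by at most `c` on `G`,
    -- so Hoeffding's lemma on an interval starting at its infimum gives the parameter `(c/2)^2`.
    set ψ : Z → ℝ := fun z => ∫ T, Φ (z, T) ∂ν with hψdef
    have hψ : Measurable ψ := (hΦ.stronglyMeasurable.integral_prod_right (ν := ν)).measurable
    set M : ℝ := ∫ T, φ T ∂π with hM
    have hM' : M = ∫ z, ψ z ∂μ := by
      rw [hM, ← hmp.map_eq, integral_map hmp.measurable.aemeasurable hφ.aestronglyMeasurable]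
      exact integral_prod _ hΦint
    have hψd : ∀ z ∈ G, ∀ w ∈ G, ψ z - ψ w ≤ c := by
      intro z hz w hw
      rw [hψdef]
      simp only
      rw [← integral_sub (hint_z z hz) (hint_z w hw)]
      refine (le_abs_self _).trans ?_
      have := norm_integral_le_of_norm_le_const (μ := ν) (f := fun T => Φ (z, T) - Φ (w, T))
        (C := c) (hGn.mono fun T hT => by
          have := hd (Fin.cons w T) (hcons w hw T hT) 0 z hz
          rwa [Fin.update_cons_zero] at this)
      simpa using this
    have hψsub : HasSubgaussianMGF (fun z => ψ z - M) ((c / 2) ^ 2) μ := by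
      rw [hM']
      have hbd : BddBelow (ψ '' G) := by
        refine ⟨ψ z₀ - c, ?_⟩
        rintro _ ⟨z, hz, rfl⟩
        linarith [hψd z₀ hz₀ z hz]
      have := hasSubgaussianMGF_of_mem_Icc (μ := μ) (X := ψ) (a := sInf (ψ '' G))
        (b := sInf (ψ '' G) + c) hψ.aemeasurable (hG.mono fun z hz => by
          refine ⟨csInf_le hbd ⟨z, hz, rfl⟩, ?_⟩
          have : ψ z - c ≤ sInf (ψ '' G) := by
            refine le_csInf ⟨_, z₀, hz₀, rfl⟩ ?_
            rintro _ ⟨w, hw, rfl⟩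
            linarith [hψd z hz w hw]
          linarith)
      simpa using this
    have hih : ∀ z ∈ G, HasSubgaussianMGF (fun T => Φ (z, T) - ψ z) (n * (c / 2) ^ 2) ν := by
      intro z hz
      refine ih (φ := fun T => Φ (z, T)) (hΦ.comp measurable_prodMk_left) fun S hS i w hw => ?_
      have := hd (Fin.cons z S) (hcons z hz S hS) i.succ w hw
      simp only [hΦdef]
      rwa [Fin.cons_update]
    have hexpint : ∀ t : ℝ, Integrable (fun p => Real.exp (t * (Φ p - M))) (μ.prod ν) := by
      intro t
      refine Integrable.of_bound
        (Real.measurable_exp.comp ((hΦ.sub_const M).const_mul t)).aestronglyMeasurable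
        (Real.exp (|t| * (b₀ + |M|))) (hGp.mono fun p hp => ?_)
      rw [Real.norm_eq_abs, Real.abs_exp]
      refine Real.exp_le_exp.2 ((le_abs_self _).trans ?_)
      rw [abs_mul]
      refine mul_le_mul_of_nonneg_left ?_ (abs_nonneg t)
      exact (abs_sub _ _).trans (add_le_add (hbound p.1 hp.1 p.2 hp.2) le_rfl)
    have hexpm : ∀ t : ℝ, Measurable fun S => Real.exp (t * (φ S - M)) := fun t =>
      Real.measurable_exp.comp ((hφ.sub_const M).const_mul t)
    refine ⟨fun t => ?_, fun t => ?_⟩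
    · exact (hmp.integrable_comp (hexpm t).aestronglyMeasurable).1 (hexpint t)
    · rw [mgf, ← hmp.map_eq,
        integral_map hmp.measurable.aemeasurable (hexpm t).aestronglyMeasurable]
      change ∫ p, Real.exp (t * (Φ p - M)) ∂(μ.prod ν) ≤ _
      rw [integral_prod _ (hexpint t)]
      -- Split `Φ - M` as `(Φ - ψ) + (ψ - M)`: for a fixed first coordinate the induction hypothesis
      -- bounds the first exponential, and the variance parameters add.
      have hstep : ∀ᵐ z ∂μ, ∫ T, Real.exp (t * (Φ (z, T) - M)) ∂ν ≤
          Real.exp (t * (ψ z - M)) * Real.exp ((n * (c / 2) ^ 2 : ℝ≥0) * t ^ 2 / 2) := by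
        refine hG.mono fun z hz => ?_
        have h1 : ∀ T, Real.exp (t * (Φ (z, T) - M)) =
            Real.exp (t * (ψ z - M)) * Real.exp (t * (Φ (z, T) - ψ z)) := by
          intro T; rw [← Real.exp_add]; ring_nf
        simp only [h1]
        rw [integral_const_mul]
        exact mul_le_mul_of_nonneg_left ((hih z hz).mgf_le t) (Real.exp_pos _).le
      refine (integral_mono_ae (hexpint t).integral_prod_left
        ((hψsub.integrable_exp_mul t).mul_const _) hstep).trans ?_
      rw [integral_mul_const]
      refine (mul_le_mul_of_nonneg_right (hψsub.mgf_le t) (Real.exp_pos _).le).trans (le_of_eq ?_)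
      rw [← Real.exp_add]
      push_cast
      ring_nf

end McDiarmid

/-! ### Symmetrization and the excess risk tail bound -/

section Symmetrization

variable {Z : Type*}

/-- The supremum over the class `H` of the sums with weights `a`, as a real number. -/
noncomputable def classSup (H : Set (Z → ℝ)) {n : ℕ} (a : Fin n → ℝ) (z : Fin n → Z) : ℝ :=
  (⨆ h ∈ H, ((∑ i, a i * h (z i) : ℝ) : EReal)).toReal

lemma MeasurableClass.measurable_classSup [MeasurableSpace Z] {H : Set (Z → ℝ)}
    (hH : MeasurableClass H) {n : ℕ} (a : Fin n → ℝ) : Measurable (classSup H a) :=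
  measurable_ereal_toReal.comp (hH n a)

/-- `toReal` sends both infinities to `0`; nonemptiness excludes `⊥` and the upper bound excludes
`⊤`. -/
lemma coe_classSup {H : Set (Z → ℝ)} (hne : H.Nonempty) {n : ℕ} {a : Fin n → ℝ} {z : Fin n → Z}
    {b : ℝ} (hb : ∀ h ∈ H, ∑ i, a i * h (z i) ≤ b) :
    (classSup H a z : EReal) = ⨆ h ∈ H, ((∑ i, a i * h (z i) : ℝ) : EReal) := by
  obtain ⟨h₀, hh₀⟩ := hne
  refine EReal.coe_toReal ?_ ?_
  · refine ne_of_lt (lt_of_le_of_lt (iSup₂_le fun h hh => ?_) (EReal.coe_lt_top b))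
    exact EReal.coe_le_coe_iff.2 (hb h hh)
  · refine ne_of_gt (lt_of_lt_of_le (EReal.bot_lt_coe _)
      (le_iSup₂ (f := fun h (_ : h ∈ H) => ((∑ i, a i * h (z i) : ℝ) : EReal)) h₀ hh₀))

lemma le_classSup {H : Set (Z → ℝ)} {n : ℕ} {a : Fin n → ℝ} {z : Fin n → Z}
    {b : ℝ} (hb : ∀ h ∈ H, ∑ i, a i * h (z i) ≤ b) {h : Z → ℝ} (hh : h ∈ H) :
    ∑ i, a i * h (z i) ≤ classSup H a z := by
  rw [← EReal.coe_le_coe_iff, coe_classSup ⟨h, hh⟩ hb]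
  exact le_iSup₂ (f := fun h (_ : h ∈ H) => ((∑ i, a i * h (z i) : ℝ) : EReal)) h hh

lemma classSup_le {H : Set (Z → ℝ)} (hne : H.Nonempty) {n : ℕ} {a : Fin n → ℝ} {z : Fin n → Z}
    {b : ℝ} (hb : ∀ h ∈ H, ∑ i, a i * h (z i) ≤ b) : classSup H a z ≤ b := by
  rw [← EReal.coe_le_coe_iff, coe_classSup hne hb]
  exact iSup₂_le fun h hh => EReal.coe_le_coe_iff.2 (hb h hh)

/-- The functions in `H` have values in `[lo, hi]` on `G`. -/
def BoundedOn (H : Set (Z → ℝ)) (G : Set Z) (lo hi : ℝ) : Prop :=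
  ∀ h ∈ H, ∀ z ∈ G, h z ∈ Set.Icc lo hi

lemma BoundedOn.abs_apply_le {H : Set (Z → ℝ)} {G : Set Z} {lo hi : ℝ} (hb : BoundedOn H G lo hi)
    {h : Z → ℝ} (hh : h ∈ H) {z : Z} (hz : z ∈ G) : |h z| ≤ |lo| + |hi| := by
  have := hb h hh z hz
  rw [Set.mem_Icc] at this
  refine abs_le.2 ⟨?_, ?_⟩
  · linarith [neg_abs_le lo, abs_nonneg hi]
  · linarith [le_abs_self hi, abs_nonneg lo]

lemma BoundedOn.abs_sum_le {H : Set (Z → ℝ)} {G : Set Z} {lo hi : ℝ} (hb : BoundedOn H G lo hi)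
    {n : ℕ} (a : Fin n → ℝ) {z : Fin n → Z} (hz : ∀ i, z i ∈ G) {h : Z → ℝ} (hh : h ∈ H) :
    |∑ i, a i * h (z i)| ≤ ∑ i, |a i| * (|lo| + |hi|) := by
  refine (Finset.abs_sum_le_sum_abs _ _).trans (Finset.sum_le_sum fun i _ => ?_)
  rw [abs_mul]
  exact mul_le_mul_of_nonneg_left (hb.abs_apply_le hh (hz i)) (abs_nonneg _)

lemma BoundedOn.sum_le_classSup {H : Set (Z → ℝ)} {G : Set Z} {lo hi : ℝ}
    (hb : BoundedOn H G lo hi) {n : ℕ} (a : Fin n → ℝ) {z : Fin n → Z} (hz : ∀ i, z i ∈ G)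
    {h : Z → ℝ} (hh : h ∈ H) : ∑ i, a i * h (z i) ≤ classSup H a z :=
  le_classSup (fun _ hh => (le_abs_self _).trans (hb.abs_sum_le a hz hh)) hh

lemma BoundedOn.abs_classSup_le {H : Set (Z → ℝ)} (hne : H.Nonempty) {G : Set Z} {lo hi : ℝ}
    (hb : BoundedOn H G lo hi) {n : ℕ} (a : Fin n → ℝ) {z : Fin n → Z} (hz : ∀ i, z i ∈ G) :
    |classSup H a z| ≤ ∑ i, |a i| * (|lo| + |hi|) := by
  obtain ⟨h, hh⟩ := hne
  refine abs_le.2 ⟨?_, classSup_le ⟨h, hh⟩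
    fun _ hh => (le_abs_self _).trans (hb.abs_sum_le a hz hh)⟩
  exact (abs_le.1 (hb.abs_sum_le a hz hh)).1.trans (hb.sum_le_classSup a hz hh)

/-- The largest difference over `H` of the weighted sums on two samples. -/
noncomputable def ghostSup (H : Set (Z → ℝ)) {n : ℕ} (w : Fin n → ℝ) (S' S : Fin n → Z) : ℝ :=
  classSup H (Fin.append w (-w)) (Fin.append S' S)

lemma sum_append {n : ℕ} (w : Fin n → ℝ) (S' S : Fin n → Z) (h : Z → ℝ) :
    ∑ i, Fin.append w (-w) i * h (Fin.append S' S i) = ∑ i, w i * (h (S' i) - h (S i)) := by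
  rw [Fin.sum_univ_add]
  simp only [Fin.append_left, Fin.append_right, Pi.neg_apply, neg_mul, Finset.sum_neg_distrib,
    mul_sub, Finset.sum_sub_distrib]
  ring

lemma append_mem {G : Set Z} {n : ℕ} {S' S : Fin n → Z} (hS' : ∀ i, S' i ∈ G) (hS : ∀ i, S i ∈ G)
    (i : Fin (n + n)) : Fin.append S' S i ∈ G := by
  refine Fin.addCases (fun i => ?_) (fun i => ?_) i
  · rw [Fin.append_left]; exact hS' i
  · rw [Fin.append_right]; exact hS i

lemma BoundedOn.le_ghostSup {H : Set (Z → ℝ)} {G : Set Z} {lo hi : ℝ}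
    (hb : BoundedOn H G lo hi) {n : ℕ} (w : Fin n → ℝ) {S' S : Fin n → Z} (hS' : ∀ i, S' i ∈ G)
    (hS : ∀ i, S i ∈ G) {h : Z → ℝ} (hh : h ∈ H) :
    ∑ i, w i * (h (S' i) - h (S i)) ≤ ghostSup H w S' S := by
  rw [← sum_append]
  exact hb.sum_le_classSup _ (append_mem hS' hS) hh

lemma ghostSup_le {H : Set (Z → ℝ)} (hne : H.Nonempty) {n : ℕ} {w : Fin n → ℝ} {S' S : Fin n → Z}
    {b : ℝ} (hb : ∀ h ∈ H, ∑ i, w i * (h (S' i) - h (S i)) ≤ b) : ghostSup H w S' S ≤ b :=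
  classSup_le hne fun h hh => by rw [sum_append]; exact hb h hh

lemma BoundedOn.abs_ghostSup_le {H : Set (Z → ℝ)} (hne : H.Nonempty) {G : Set Z} {lo hi : ℝ}
    (hb : BoundedOn H G lo hi) {n : ℕ} (w : Fin n → ℝ) {S' S : Fin n → Z} (hS' : ∀ i, S' i ∈ G)
    (hS : ∀ i, S i ∈ G) :
    |ghostSup H w S' S| ≤ ∑ i, |Fin.append w (-w) i| * (|lo| + |hi|) :=
  hb.abs_classSup_le hne _ (append_mem hS' hS)

lemma BoundedOn.ghostSup_update_le {H : Set (Z → ℝ)} (hne : H.Nonempty) {G : Set Z} {lo hi : ℝ}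
    (hb : BoundedOn H G lo hi) {n : ℕ} {w : Fin n → ℝ} {r : ℝ} (hw : ∀ i, |w i| ≤ r)
    {S' S : Fin n → Z} (hS' : ∀ i, S' i ∈ G)
    (hS : ∀ i, S i ∈ G) (i : Fin n) {z : Z} (hz : z ∈ G) :
    ghostSup H w S' (Function.update S i z) ≤ ghostSup H w S' S + r * (hi - lo) := by
  refine ghostSup_le hne fun h hh => ?_
  have h1 := hb.le_ghostSup w hS' hS hh
  have h2 : ∑ j, w j * (h (S' j) - h (Function.update S i z j)) -
      ∑ j, w j * (h (S' j) - h (S j)) = w i * (h (S i) - h z) := by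
    rw [← Finset.sum_sub_distrib, Finset.sum_eq_single i]
    · simp; ring
    · intro j _ hj; simp [Function.update_of_ne hj]
    · simp
  have h3 : w i * (h (S i) - h z) ≤ r * (hi - lo) := by
    refine (le_abs_self _).trans ?_
    rw [abs_mul]
    refine mul_le_mul (hw i) ?_ (abs_nonneg _) ((abs_nonneg _).trans (hw i))
    have e1 := hb h hh _ (hS i)
    have e2 := hb h hh _ hz
    rw [Set.mem_Icc] at e1 e2
    exact abs_le.2 ⟨by linarith, by linarith⟩
  linarith

lemma BoundedOn.abs_ghostSup_update_sub_le {H : Set (Z → ℝ)} (hne : H.Nonempty) {G : Set Z}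
    {lo hi : ℝ} (hb : BoundedOn H G lo hi) {n : ℕ} {w : Fin n → ℝ} {r : ℝ} (hw : ∀ i, |w i| ≤ r)
    {S' S : Fin n → Z} (hS' : ∀ i, S' i ∈ G)
    (hS : ∀ i, S i ∈ G) (i : Fin n) {z : Z} (hz : z ∈ G) :
    |ghostSup H w S' (Function.update S i z) - ghostSup H w S' S| ≤ r * (hi - lo) := by
  have h1 := hb.ghostSup_update_le hne hw hS' hS i hz
  have h2 := hb.ghostSup_update_le hne hw hS' (S := Function.update S i z)
    (fun j => by by_cases hj : j = i <;> [(subst hj; simpa using hz); simpa [hj] using hS j]) i (hS i)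
  rw [Function.update_idem, Function.update_eq_self] at h2
  exact abs_le.2 ⟨by linarith, by linarith⟩

variable [MeasurableSpace Z]

/-- Two samples count as one sample of length `n + n` with weights `w` and `-w`, so joint
measurability is an instance of the assumption on `H`. -/
lemma MeasurableClass.measurable_ghostSup {H : Set (Z → ℝ)} (hH : MeasurableClass H) {n : ℕ}
    (w : Fin n → ℝ) : Measurable fun p : (Fin n → Z) × (Fin n → Z) => ghostSup H w p.1 p.2 := by
  refine (hH.measurable_classSup _).comp (measurable_pi_iff.2 fun i => ?_)
  refine Fin.addCases (fun i => ?_) (fun i => ?_) i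
  · simp only [Fin.append_left]; exact (measurable_pi_apply i).comp measurable_fst
  · simp only [Fin.append_right]; exact (measurable_pi_apply i).comp measurable_snd

/-- Exchanging the points of two independent samples at the indices where `σ` is false. -/
def swapSample {n : ℕ} (σ : Fin n → Bool) (p : (Fin n → Z) × (Fin n → Z)) :
    (Fin n → Z) × (Fin n → Z) :=
  (fun i => if σ i then p.1 i else p.2 i, fun i => if σ i then p.2 i else p.1 i)

lemma measurePreserving_swapSample (μ : Measure Z) [IsProbabilityMeasure μ] {n : ℕ}
    (σ : Fin n → Bool) :
    MeasurePreserving (swapSample (Z := Z) σ)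
      ((Measure.pi fun _ => μ).prod (Measure.pi fun _ => μ))
      ((Measure.pi fun _ => μ).prod (Measure.pi fun _ => μ)) := by
  have h1 := measurePreserving_arrowProdEquivProdArrow Z Z (Fin n) (fun _ => μ) (fun _ => μ)
  have h2 := measurePreserving_pi (fun _ : Fin n => μ.prod μ) (fun _ => μ.prod μ)
    (f := fun i => if σ i then id else Prod.swap) (fun i => by
      by_cases h : σ i
      · simpa [h] using MeasurePreserving.id _
      · simpa [h] using Measure.measurePreserving_swap)
  have h3 := (h1.comp h2).comp h1.symm
  convert h3 using 1
  ext p i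
  · by_cases h : σ i <;>
      simp [swapSample, h, MeasurableEquiv.arrowProdEquivProdArrow, Equiv.arrowProdEquivProdArrow]
  · by_cases h : σ i <;>
      simp [swapSample, h, MeasurableEquiv.arrowProdEquivProdArrow, Equiv.arrowProdEquivProdArrow]

-- Exchanging the two points at index `i` reverses the sign of their difference, which is how random
-- signs enter.
omit [MeasurableSpace Z] in
lemma ghostSup_swapSample (H : Set (Z → ℝ)) {n : ℕ} (r : ℝ) (σ : Fin n → Bool)
    (p : (Fin n → Z) × (Fin n → Z)) :
    ghostSup H (fun _ => r) (swapSample σ p).1 (swapSample σ p).2 =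
      ghostSup H (fun i => r * sgn (σ i)) p.1 p.2 := by
  unfold ghostSup classSup
  congr 1
  refine iSup_congr fun h => iSup_congr fun _ => ?_
  rw [sum_append, sum_append]
  congr 1
  refine Finset.sum_congr rfl fun i _ => ?_
  cases hσ : σ i <;> simp [swapSample, sgn, hσ]
  ring

variable {μ : Measure Z} [IsProbabilityMeasure μ] {H : Set (Z → ℝ)} {G : Set Z} {lo hi : ℝ}

/-- The expected Rademacher average of the class `H`, as a real number. -/
noncomputable def rademacherReal (μ : Measure Z) (n : ℕ) (H : Set (Z → ℝ)) : ℝ :=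
  ∫ z, 𝔼 σ : Fin n → Bool, classSup H (fun i => 1 / (n : ℝ) * sgn (σ i)) z
    ∂(Measure.pi fun _ : Fin n => μ)

lemma integrable_classSup (hne : H.Nonempty) (hH : MeasurableClass H)
    (hG : ∀ᵐ z ∂μ, z ∈ G) (hb : BoundedOn H G lo hi) {n : ℕ} (a : Fin n → ℝ) :
    Integrable (classSup H a) (Measure.pi fun _ : Fin n => μ) :=
  Integrable.of_bound (hH.measurable_classSup a).aestronglyMeasurable _
    ((ae_pi_mem hG n).mono fun _ hz => hb.abs_classSup_le hne a hz)

lemma ae_prod_pi_mem (hG : ∀ᵐ z ∂μ, z ∈ G) (n : ℕ) :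
    ∀ᵐ p ∂((Measure.pi fun _ : Fin n => μ).prod (Measure.pi fun _ : Fin n => μ)),
      (∀ i, p.1 i ∈ G) ∧ ∀ i, p.2 i ∈ G :=
  (Measure.quasiMeasurePreserving_fst.ae (ae_pi_mem hG n)).and
    (Measure.quasiMeasurePreserving_snd.ae (ae_pi_mem hG n))

lemma integrable_ghostSup (hne : H.Nonempty) (hH : MeasurableClass H)
    (hG : ∀ᵐ z ∂μ, z ∈ G) (hb : BoundedOn H G lo hi) {n : ℕ} (w : Fin n → ℝ) :
    Integrable (fun p : (Fin n → Z) × (Fin n → Z) => ghostSup H w p.1 p.2)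
      ((Measure.pi fun _ : Fin n => μ).prod (Measure.pi fun _ : Fin n => μ)) :=
  Integrable.of_bound (hH.measurable_ghostSup w).aestronglyMeasurable _
    ((ae_prod_pi_mem hG n).mono fun _ hp => hb.abs_ghostSup_le hne w hp.1 hp.2)

/-- Swapping leaves the law of the pair of samples unchanged, so the integral can be averaged over
all `σ`. The supremum of a difference then splits into two parts with equal averages, since `-σ` is
distributed like `σ`. -/
lemma integral_ghostSup_le (hne : H.Nonempty) (hH : MeasurableClass H)
    (hG : ∀ᵐ z ∂μ, z ∈ G) (hb : BoundedOn H G lo hi) (n : ℕ) :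
    ∫ p, ghostSup H (fun _ => 1 / (n : ℝ)) p.1 p.2
      ∂((Measure.pi fun _ : Fin n => μ).prod (Measure.pi fun _ : Fin n => μ)) ≤
      2 * rademacherReal μ n H := by
  set ν : Measure (Fin n → Z) := Measure.pi fun _ => μ with hν
  set r : ℝ := 1 / (n : ℝ)
  have hcs := fun a : Fin n → ℝ => integrable_classSup (μ := μ) hne hH hG hb a
  have h1 : ∀ σ : Fin n → Bool, ∫ p, ghostSup H (fun _ => r) p.1 p.2 ∂(ν.prod ν) =
      ∫ p, ghostSup H (fun i => r * sgn (σ i)) p.1 p.2 ∂(ν.prod ν) := by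
    intro σ
    have hmp := measurePreserving_swapSample μ σ
    rw [← hν] at hmp
    conv_lhs => rw [← hmp.map_eq]
    rw [integral_map hmp.measurable.aemeasurable
      (hH.measurable_ghostSup _).aestronglyMeasurable]
    simp only [ghostSup_swapSample]
  have h2 : ∀ σ : Fin n → Bool, ∫ p, ghostSup H (fun i => r * sgn (σ i)) p.1 p.2 ∂(ν.prod ν) ≤
      ∫ z, classSup H (fun i => r * sgn (σ i)) z ∂ν +
        ∫ z, classSup H (fun i => r * (-sgn (σ i))) z ∂ν := by
    intro σ
    have e1 : ∫ z, classSup H (fun i => r * sgn (σ i)) z ∂ν =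
        ∫ p, classSup H (fun i => r * sgn (σ i)) p.1 ∂(ν.prod ν) := by
      rw [integral_fun_fst]; simp
    have e2 : ∫ z, classSup H (fun i => r * (-sgn (σ i))) z ∂ν =
        ∫ p, classSup H (fun i => r * (-sgn (σ i))) p.2 ∂(ν.prod ν) := by
      rw [integral_fun_snd]; simp
    rw [e1, e2, ← integral_add ((hcs _).comp_fst ν) ((hcs _).comp_snd ν)]
    refine integral_mono_ae (integrable_ghostSup hne hH hG hb _)
      (((hcs _).comp_fst ν).add ((hcs _).comp_snd ν)) ((ae_prod_pi_mem hG n).mono fun p hp => ?_)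
    refine ghostSup_le hne fun h hh => ?_
    refine le_trans (le_of_eq ?_) (add_le_add (hb.sum_le_classSup (fun i => r * sgn (σ i)) hp.1 hh)
      (hb.sum_le_classSup (fun i => r * (-sgn (σ i))) hp.2 hh))
    rw [← Finset.sum_add_distrib]
    exact Finset.sum_congr rfl fun i _ => by ring
  have h3 : ∫ p, ghostSup H (fun _ => r) p.1 p.2 ∂(ν.prod ν) ≤ 𝔼 σ : Fin n → Bool,
      (∫ z, classSup H (fun i => r * sgn (σ i)) z ∂ν +
        ∫ z, classSup H (fun i => r * (-sgn (σ i))) z ∂ν) :=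
    Finset.le_expect Finset.univ_nonempty fun σ _ => (h1 σ).trans_le (h2 σ)
  refine h3.trans (le_of_eq ?_)
  rw [Finset.expect_add_distrib,
    expect_sgn_neg (fun s => ∫ z, classSup H (fun i => r * s i) z ∂ν), ← two_mul]
  congr 1
  rw [rademacherReal]
  simp only [Fintype.expect_eq_sum_div_card]
  rw [integral_div, integral_finsetSum _ fun σ _ => hcs _]

/-- The mean of `h` is the expected average on a ghost sample, and each `h` is dominated by the
supremum inside the integral. -/
lemma integral_sub_average_le (hne : H.Nonempty) (hH : MeasurableClass H)
    (hG : ∀ᵐ z ∂μ, z ∈ G) (hb : BoundedOn H G lo hi) {n : ℕ} (hn : n ≠ 0) {h : Z → ℝ} (hh : h ∈ H)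
    (hm : AEStronglyMeasurable h μ) {S : Fin n → Z} (hS : ∀ i, S i ∈ G) :
    ∫ z, h z ∂μ - (1 / (n : ℝ)) * ∑ i, h (S i) ≤
      ∫ S', ghostSup H (fun _ => 1 / (n : ℝ)) S' S ∂(Measure.pi fun _ : Fin n => μ) := by
  set ν : Measure (Fin n → Z) := Measure.pi fun _ => μ with hν
  have hint : Integrable h μ := Integrable.of_bound hm _ (hG.mono fun z hz => hb.abs_apply_le hh hz)
  have hint' : ∀ i, Integrable (fun S' : Fin n → Z => h (S' i)) ν := fun i =>
    (measurePreserving_eval (fun _ : Fin n => μ) i).integrable_comp_of_integrable hint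
  have hint'' : ∀ i, Integrable (fun S' : Fin n → Z => 1 / (n : ℝ) * (h (S' i) - h (S i))) ν :=
    fun i => ((hint' i).sub (integrable_const _)).const_mul _
  have hev : ∀ i, ∫ S', h (S' i) ∂ν = ∫ z, h z ∂μ := by
    intro i
    have := measurePreserving_eval (fun _ : Fin n => μ) i
    conv_rhs => rw [← this.map_eq]
    rw [integral_map this.measurable.aemeasurable (by rwa [this.map_eq])]
  have h1 : ∫ z, h z ∂μ - (1 / (n : ℝ)) * ∑ i, h (S i) =
      ∫ S', ∑ i, 1 / (n : ℝ) * (h (S' i) - h (S i)) ∂ν := by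
    rw [integral_finsetSum _ fun i _ => hint'' i]
    simp_rw [integral_const_mul, integral_sub (hint' _) (integrable_const _), hev]
    have : (n : ℝ) ≠ 0 := by exact_mod_cast hn
    simp [← Finset.mul_sum, Finset.sum_sub_distrib, mul_sub, this]
  rw [h1]
  refine integral_mono_ae (integrable_finsetSum _ fun i _ => hint'' i)
    (Integrable.of_bound ((hH.measurable_ghostSup _).comp measurable_prodMk_right).aestronglyMeasurable
      _ ((ae_pi_mem hG n).mono fun S' hS' => hb.abs_ghostSup_le hne _ hS' hS))
    ((ae_pi_mem hG n).mono fun S' hS' => hb.le_ghostSup (fun _ => 1 / (n : ℝ)) hS' hS hh)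

/-- An excess risk bound for functions in `H` whose empirical mean is at most that of `h₀`. -/
theorem measure_exists_excess_le (hH : MeasurableClass H)
    (hG : ∀ᵐ z ∂μ, z ∈ G) (hb : BoundedOn H G lo hi)
    (hm : ∀ h ∈ H, ∃ h' : Z → ℝ, Measurable h' ∧ Set.EqOn h h' G)
    {n : ℕ} (hn : n ≠ 0) {h₀ : Z → ℝ} (hh₀ : h₀ ∈ H) {t : ℝ} (ht : 0 ≤ t) :
    (Measure.pi fun _ : Fin n => μ)
      {S | ∃ h ∈ H, (1 / (n : ℝ)) * ∑ i, h (S i) ≤ (1 / (n : ℝ)) * ∑ i, h₀ (S i) ∧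
        2 * rademacherReal μ n H + t < ∫ z, h z ∂μ - ∫ z, h₀ z ∂μ} ≤
      ENNReal.ofReal (Real.exp (-(n * t ^ 2 / (2 * (hi - lo) ^ 2)))) := by
  have hne : H.Nonempty := ⟨h₀, hh₀⟩
  set ν : Measure (Fin n → Z) := Measure.pi fun _ => μ with hν
  set r : ℝ := 1 / (n : ℝ) with hr
  have hn0 : (0 : ℝ) < n := by exact_mod_cast Nat.pos_of_ne_zero hn
  have hr0 : 0 ≤ r := by positivity
  have hae : ∀ h ∈ H, AEStronglyMeasurable h μ := by
    intro h hh
    obtain ⟨h', hm', he⟩ := hm h hh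
    exact hm'.aestronglyMeasurable.congr (hG.mono fun z hz => (he hz).symm)
  obtain ⟨k, hk, hke⟩ := hm h₀ hh₀
  have hlohi : lo ≤ hi := by
    obtain ⟨z, hz⟩ := hG.exists
    exact (hb h₀ hh₀ z hz).1.trans (hb h₀ hh₀ z hz).2
  have hab : ∀ i : Fin n, |(fun _ => r) i| ≤ r := fun _ => (abs_of_nonneg hr0).le
  -- `φ` dominates the largest deviation and is measurable as an integral of a jointly measurable
  -- function, so the supremum of the deviations themselves never has to be measurable.
  set φ : (Fin n → Z) → ℝ := fun S => ∫ S', ghostSup H (fun _ => r) S' S ∂ν with hφdef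
  have hgi := integrable_ghostSup (μ := μ) hne hH hG hb (fun _ : Fin n => r)
  have hφm : Measurable φ :=
    ((hH.measurable_ghostSup
      (fun _ : Fin n => r)).stronglyMeasurable.integral_prod_left (μ := ν)).measurable
  have hφi : Integrable φ ν := hgi.integral_prod_right
  have hφle : ∫ S, φ S ∂ν ≤ 2 * rademacherReal μ n H := by
    refine le_trans (le_of_eq ?_) (integral_ghostSup_le hne hH hG hb n)
    rw [integral_prod_symm _ hgi]
  have hki : Integrable k μ := by
    refine Integrable.of_bound hk.aestronglyMeasurable (|lo| + |hi|) (hG.mono fun z hz => ?_)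
    rw [← hke hz]; exact hb.abs_apply_le hh₀ hz
  have hkint : ∫ z, h₀ z ∂μ = ∫ z, k z ∂μ := integral_congr_ae (hG.mono fun z hz => hke hz)
  set ψ : (Fin n → Z) → ℝ := fun S => r * ∑ i, k (S i) with hψdef
  have hψm : Measurable ψ := by fun_prop
  have hkii : ∀ i, Integrable (fun S : Fin n → Z => k (S i)) ν := fun i =>
    (measurePreserving_eval (fun _ : Fin n => μ) i).integrable_comp_of_integrable hki
  have hψint : ∫ S, ψ S ∂ν = ∫ z, h₀ z ∂μ := by
    have hev : ∀ i, ∫ S', k (S' i) ∂ν = ∫ z, k z ∂μ := by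
      intro i
      have := measurePreserving_eval (fun _ : Fin n => μ) i
      conv_rhs => rw [← this.map_eq]
      rw [integral_map this.measurable.aemeasurable (by rw [this.map_eq]; exact hki.1)]
    rw [hψdef, integral_const_mul, integral_finsetSum _ fun i _ => hkii i, hkint]
    simp only [hev]
    simp [hr, hn0.ne']
  have hψi : Integrable ψ ν := (integrable_finsetSum _ fun i _ => hkii i).const_mul r
  have hc0 : 0 ≤ 2 * (r * (hi - lo)) := by have := sub_nonneg.2 hlohi; positivity
  -- `φ` and `ψ` each change by at most `(hi - lo)/n` when one point changes, hence the factor `2`.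
  have hsub := hasSubgaussianMGF_of_bounded_differences μ hG
    (c := (2 * (r * (hi - lo))).toNNReal)
    (φ := fun S => φ S + ψ S) (hφm.add hψm) (by
      intro S hS i z hz
      have hup : ∀ j, Function.update S i z j ∈ G := fun j => by
        by_cases hj : j = i <;> [(subst hj; simpa using hz); simpa [hj] using hS j]
      have hsl : ∀ S : Fin n → Z, (∀ i, S i ∈ G) → Integrable (fun S' => ghostSup H (fun _ => r) S' S) ν :=
        fun S hS => Integrable.of_bound
          ((hH.measurable_ghostSup _).comp measurable_prodMk_right).aestronglyMeasurable
          _ ((ae_pi_mem hG n).mono fun S' hS' => hb.abs_ghostSup_le hne _ hS' hS)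
      have e1 : |φ (Function.update S i z) - φ S| ≤ r * (hi - lo) := by
        rw [hφdef]
        simp only
        rw [← integral_sub (hsl _ hup) (hsl _ hS)]
        have := norm_integral_le_of_norm_le_const (μ := ν)
          (f := fun S' => ghostSup H (fun _ => r) S' (Function.update S i z) -
            ghostSup H (fun _ => r) S' S) ((ae_pi_mem hG n).mono fun S' hS' =>
          hb.abs_ghostSup_update_sub_le hne hab hS' hS i hz)
        simpa using this
      have e2 : |ψ (Function.update S i z) - ψ S| ≤ r * (hi - lo) := by
        have : ψ (Function.update S i z) - ψ S = r * (k z - k (S i)) := by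
          rw [hψdef]
          simp only
          rw [← mul_sub, ← Finset.sum_sub_distrib, Finset.sum_eq_single i]
          · simp
          · intro j _ hj; simp [Function.update_of_ne hj]
          · simp
        rw [this, abs_mul, abs_of_nonneg hr0]
        refine mul_le_mul_of_nonneg_left ?_ hr0
        have f1 := hb h₀ hh₀ _ (hS i)
        have f2 := hb h₀ hh₀ _ hz
        rw [hke (hS i)] at f1
        rw [hke hz] at f2
        exact abs_le.2 ⟨by linarith [f1.1, f1.2, f2.1, f2.2], by linarith [f1.1, f1.2, f2.1, f2.2]⟩
      refine (le_of_eq ?_).trans ((abs_add_le _ _).trans ((add_le_add e1 e2).trans (le_of_eq ?_)))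
      · congr 1; ring
      · rw [Real.coe_toNNReal _ hc0]; ring)
  have htail := hsub.measure_ge_le ht
  have hsubset : {S | ∃ h ∈ H, r * ∑ i, h (S i) ≤ r * ∑ i, h₀ (S i) ∧
        2 * rademacherReal μ n H + t < ∫ z, h z ∂μ - ∫ z, h₀ z ∂μ} ≤ᵐ[ν]
      {S | t ≤ φ S + ψ S - ∫ T, (φ T + ψ T) ∂ν} := by
    refine (ae_pi_mem hG n).mono fun S hS => ?_
    rintro ⟨h, hh, h1, h2⟩
    have h3 := integral_sub_average_le hne hH hG hb hn hh (hae h hh) hS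
    have h4 : r * ∑ i, h₀ (S i) = ψ S := by
      rw [hψdef]; simp only
      congr 1
      exact Finset.sum_congr rfl fun i _ => hke (hS i)
    change t ≤ φ S + ψ S - ∫ T, (φ T + ψ T) ∂ν
    rw [integral_add hφi hψi, hψint]
    change _ ≤ φ S at h3
    linarith
  refine (measure_mono_ae hsubset).trans ?_
  rw [← ofReal_measureReal]
  refine ENNReal.ofReal_le_ofReal (htail.trans (le_of_eq ?_))
  congr 1
  push_cast
  rw [Real.coe_toNNReal _ hc0, hr]
  -- If `hi = lo`, both exponents are quotients by `0`, hence `0`.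
  by_cases hz : hi - lo = 0
  · simp [hz]
  · field_simp

end Symmetrization

/-! ### Unbiasedness, measurability and range of the label loss -/

section Labels

variable {K I : ℕ}

/-- The weight of the classes outside the label in `isInLoss`. -/
noncomputable def outWeight (K I : ℕ) : ℝ :=
  (2 * (I : ℝ) ^ 2 + (K : ℝ) ^ 2 - K * (2 * I + 1)) / (2 * I * (K - I))

lemma isInLoss_eq (L : Score K → Fin K → ℝ) (v : Score K) (s : Finset (Fin K)) :
    isInLoss L I v s = ∑ y ∈ s, L v y - outWeight K I * ∑ y ∈ sᶜ, L v y := rfl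

lemma one_add_outWeight (hI : 1 ≤ I) (hIK : I < K) :
    1 + outWeight K I = (K : ℝ) * (K - 1) / (2 * I * (K - I)) := by
  have h1 : (I : ℝ) ≠ 0 := by positivity
  have h2 : (K : ℝ) - I ≠ 0 := sub_ne_zero.2 (by exact_mod_cast hIK.ne')
  rw [outWeight]
  field_simp
  ring

lemma outWeight_nonneg (hI : 1 ≤ I) (hIK : I < K) : 0 ≤ outWeight K I := by
  have h1 : (1 : ℝ) ≤ I := by exact_mod_cast hI
  have h2 : (I : ℝ) + 1 ≤ K := by exact_mod_cast hIK
  refine div_nonneg ?_ (mul_nonneg (by linarith) (by linarith))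
  -- The numerator equals `I(I-1) + (K-I)(K-I-1)`.
  nlinarith [mul_nonneg (sub_nonneg.2 h1) (zero_le_one.trans h1),
    mul_nonneg (show (0 : ℝ) ≤ K - I by linarith) (show (0 : ℝ) ≤ K - I - 1 by linarith)]

lemma card_mem_notMem {m j : ℕ} {y z : Fin (m + 2)} (hyz : y ≠ z) :
    (((Finset.univ : Finset (Fin (m + 2))).powersetCard (j + 1)).filter
      (fun q => y ∈ q ∧ z ∉ q)).card = m.choose j := by
  have h : ((Finset.univ : Finset (Fin (m + 2))).powersetCard (j + 1)).filter
      (fun q => y ∈ q ∧ z ∉ q) =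
      (Finset.univ.erase z).powersetCard (j + 1) \
        ((Finset.univ.erase z).erase y).powersetCard (j + 1) := by
    ext q
    simp only [Finset.mem_filter, Finset.mem_powersetCard, Finset.mem_sdiff,
      Finset.subset_erase, Finset.subset_univ, true_and]
    tauto
  rw [h, Finset.card_sdiff_of_subset (Finset.powersetCard_mono (Finset.erase_subset _ _)),
    Finset.card_powersetCard, Finset.card_powersetCard,
    Finset.card_erase_of_mem (Finset.mem_erase.2 ⟨hyz, Finset.mem_univ _⟩),
    Finset.card_erase_of_mem (Finset.mem_univ _)]
  simp [Nat.choose_succ_succ]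

lemma card_isInLabel {z : Fin K} {q : Finset (Fin K)} (hq : q.card = I) :
    (isInLabel z q).card = I ∨ (isInLabel z q).card = K - I := by
  unfold isInLabel
  split_ifs
  · exact Or.inl hq
  · right; rw [Finset.card_compl, hq, Fintype.card_fin]

/-- The class `y` is left out exactly when the question separates `y` from `z`, in either direction.
-/
lemma card_notMem_isInLabel {m j : ℕ} {y z : Fin (m + 2)} (hyz : y ≠ z) :
    (((Finset.univ : Finset (Fin (m + 2))).powersetCard (j + 1)).filter
      (fun q => y ∉ isInLabel z q)).card = 2 * m.choose j := by
  have h : ((Finset.univ : Finset (Fin (m + 2))).powersetCard (j + 1)).filter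
      (fun q => y ∉ isInLabel z q) =
      ((Finset.univ : Finset (Fin (m + 2))).powersetCard (j + 1)).filter
        (fun q => y ∈ q ∧ z ∉ q) ∪
      ((Finset.univ : Finset (Fin (m + 2))).powersetCard (j + 1)).filter
        (fun q => z ∈ q ∧ y ∉ q) := by
    rw [← Finset.filter_or]
    refine Finset.filter_congr fun q _ => ?_
    unfold isInLabel
    split_ifs with hz <;> simp [hz]
  rw [h, Finset.card_union_of_disjoint, card_mem_notMem hyz, card_mem_notMem hyz.symm, two_mul]
  rw [Finset.disjoint_filter]
  tauto

lemma mem_isInLabel_self (z : Fin K) (q : Finset (Fin K)) : z ∈ isInLabel z q := by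
  unfold isInLabel
  split_ifs with h <;> simp [h]

lemma one_add_outWeight_mul_card (hI : 1 ≤ I) (hIK : I < K) {y z : Fin K} (hyz : y ≠ z) :
    (1 + outWeight K I) * ((((Finset.univ : Finset (Fin K)).powersetCard I).filter
      (fun q => y ∉ isInLabel z q)).card : ℝ) = K.choose I := by
  obtain ⟨j, rfl⟩ : ∃ j, I = j + 1 := ⟨I - 1, by omega⟩
  obtain ⟨m, rfl⟩ : ∃ m, K = m + 2 := ⟨K - 2, by omega⟩
  have hjm : j ≤ m := by omega
  rw [one_add_outWeight hI hIK, card_notMem_isInLabel hyz]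
  have h1 := Nat.add_one_mul_choose_eq (m + 1) j
  have h2 := Nat.choose_mul_succ_eq m j
  have h1' : ((m : ℝ) + 1 + 1) * ((m + 1).choose j : ℝ) = ((m + 2).choose (j + 1) : ℝ) * (j + 1) := by
    exact_mod_cast h1
  have h2' : (m.choose j : ℝ) * (m + 1) = ((m + 1).choose j : ℝ) * (m + 1 - j) := by
    have : ((m + 1 - j : ℕ) : ℝ) = m + 1 - j := by rw [Nat.cast_sub (by omega)]; push_cast; ring
    rw [← this]; exact_mod_cast h2
  have p1 : (0 : ℝ) < j + 1 := by positivity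
  have p2 : (0 : ℝ) < m + 1 - j := by
    have : (j : ℝ) ≤ m := by exact_mod_cast hjm
    linarith
  push_cast
  have e : (2 * ((j : ℝ) + 1) * ((m : ℝ) + 2 - (j + 1))) ≠ 0 := by
    have : (m : ℝ) + 2 - (j + 1) = m + 1 - j := by ring
    rw [this]; positivity
  rw [div_mul_eq_mul_div, div_eq_iff e]
  linear_combination (2 * ((m : ℝ) + 2)) * h2' + 2 * (m + 1 - j) * h1'

/-- Here the label enters only through an indicator. Averaged over the questions, the coefficient is
`1` at the true class and `0` elsewhere. -/
lemma isInLoss_eq_sum (L : Score K → Fin K → ℝ) (v : Score K) (s : Finset (Fin K)) :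
    isInLoss L I v s = ∑ y, (1 - (1 + outWeight K I) * if y ∉ s then 1 else 0) * L v y := by
  rw [isInLoss_eq, ← Finset.sum_add_sum_compl s, sub_eq_add_neg, ← neg_mul, Finset.mul_sum]
  congr 1
  · refine Finset.sum_congr rfl fun y hy => ?_
    simp [hy]
  · refine Finset.sum_congr rfl fun y hy => ?_
    rw [Finset.mem_compl] at hy
    simp [hy]

/-- Averaging the label loss over the questions recovers the ordinary loss. -/
lemma sum_isInLoss_isInLabel (hI : 1 ≤ I) (hIK : I < K) (L : Score K → Fin K → ℝ) (v : Score K)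
    (z : Fin K) :
    ∑ q ∈ (Finset.univ : Finset (Fin K)).powersetCard I, isInLoss L I v (isInLabel z q) =
      K.choose I * L v z := by
  simp only [isInLoss_eq_sum]
  rw [Finset.sum_comm, Finset.sum_eq_single z]
  · simp [mem_isInLabel_self]
  · intro y _ hy
    rw [← Finset.sum_mul, Finset.sum_sub_distrib, ← Finset.mul_sum, Finset.sum_boole,
      one_add_outWeight_mul_card hI hIK hy]
    simp
  · simp

lemma questions_eq : {q : Finset (Fin K) | q.card = I} =
    ((Finset.univ : Finset (Fin K)).powersetCard I : Set (Finset (Fin K))) := by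
  ext q; simp

lemma isProbabilityMeasure_questions (hIK : I < K) :
    IsProbabilityMeasure (uniformOn {q : Finset (Fin K) | q.card = I}) := by
  refine isProbabilityMeasure_uniformOn (Set.toFinite _) ?_
  rw [questions_eq, Finset.coe_nonempty, Finset.powersetCard_nonempty]
  simpa using hIK.le

lemma ae_questions : ∀ᵐ q ∂(uniformOn {q : Finset (Fin K) | q.card = I}), q.card = I :=
  ae_cond_mem (MeasurableSet.of_discrete)

lemma integral_questions (Ψ : Finset (Fin K) → ℝ) :
    ∫ q, Ψ q ∂(uniformOn {q : Finset (Fin K) | q.card = I}) =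
      (K.choose I : ℝ)⁻¹ * ∑ q ∈ (Finset.univ : Finset (Fin K)).powersetCard I, Ψ q := by
  rw [questions_eq, uniformOn, ProbabilityTheory.cond, integral_smul_measure,
    Measure.count_apply_finset, ← integral_indicator MeasurableSet.of_discrete, integral_count]
  simp [Finset.sum_indicator_subset]

variable {X : Type u} [MeasurableSpace X]

lemma measurable_isInLabel :
    Measurable fun w : (X × Fin K) × Finset (Fin K) => (w.1.1, isInLabel w.1.2 w.2) := by
  have h : Measurable fun w : Fin K × Finset (Fin K) => isInLabel w.1 w.2 := .of_discrete
  exact (measurable_fst.comp measurable_fst).prodMk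
    (h.comp ((measurable_snd.comp measurable_fst).prodMk measurable_snd))

lemma isProbabilityMeasure_isInLaw (hIK : I < K) (P : Measure (X × Fin K))
    [IsProbabilityMeasure P] : IsProbabilityMeasure (isInLaw P I) := by
  have := isProbabilityMeasure_questions hIK
  exact Measure.isProbabilityMeasure_map measurable_isInLabel.aemeasurable

lemma ae_isInLaw (hIK : I < K) (P : Measure (X × Fin K)) [IsProbabilityMeasure P] :
    ∀ᵐ w ∂(isInLaw P I), w ∈ {w : X × Finset (Fin K) | w.2.card = I ∨ w.2.card = K - I} := by
  have := isProbabilityMeasure_questions hIK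
  have hG : MeasurableSet {w : X × Finset (Fin K) | w.2.card = I ∨ w.2.card = K - I} :=
    measurable_snd (MeasurableSet.of_discrete (s := {s : Finset (Fin K) | s.card = I ∨ s.card = K - I}))
  rw [isInLaw]
  refine (ae_map_iff measurable_isInLabel.aemeasurable hG).2 ?_
  exact (Measure.quasiMeasurePreserving_snd.ae ae_questions).mono fun w hw => card_isInLabel hw

lemma measurePreserving_fst_isInLaw (hIK : I < K) (P : Measure (X × Fin K))
    [IsProbabilityMeasure P] : MeasurePreserving Prod.fst (isInLaw P I) P.fst := by
  have := isProbabilityMeasure_questions hIK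
  refine ⟨measurable_fst, ?_⟩
  rw [isInLaw, Measure.map_map measurable_fst measurable_isInLabel]
  change (P.prod _).map (Prod.fst ∘ Prod.fst) = _
  rw [← Measure.map_map measurable_fst measurable_fst]
  change (P.prod _).fst.map Prod.fst = _
  rw [Measure.fst_prod]
  rfl

variable {L : Score K → Fin K → ℝ}

lemma loss_eq_sum (hI : 1 ≤ I) (hIK : I < K) (L : Score K → Fin K → ℝ) (v : Score K) (z : Fin K) :
    L v z = (K.choose I : ℝ)⁻¹ *
      ∑ q ∈ (Finset.univ : Finset (Fin K)).powersetCard I, isInLoss L I v (isInLabel z q) := by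
  have : (K.choose I : ℝ) ≠ 0 := by exact_mod_cast (Nat.choose_pos hIK.le).ne'
  rw [sum_isInLoss_isInLabel hI hIK, inv_mul_cancel_left₀ this]

/-- `L` is recovered as an average of label losses. Each is Lipschitz on `A`, so it extends to a
continuous function on the whole space. -/
lemma measurable_loss (hI : 1 ≤ I) (hIK : I < K) {A : Set (Score K)} {ρ : ℝ≥0}
    (hρ : ∀ s : Finset (Fin K), s.card = I ∨ s.card = K - I →
      LipschitzOnWith ρ (fun v => isInLoss L I v s) A)
    {f : X → Score K} (hf : Measurable f) (hfA : ∀ x, f x ∈ A) (y : Fin K) :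
    Measurable fun x => L (f x) y := by
  simp only [fun v => loss_eq_sum hI hIK L v y]
  refine (Finset.measurable_sum _ fun q hq => ?_).const_mul _
  obtain ⟨k, hk, he⟩ := (hρ _ (card_isInLabel (z := y) (Finset.mem_powersetCard.1 hq).2)).extend_real
  have e : (fun x => isInLoss L I (f x) (isInLabel y q)) = k ∘ f := funext fun x => he (hfA x)
  rw [e]
  exact hk.continuous.measurable.comp hf

lemma measurable_isInLoss {f : X → Score K} (hL : ∀ y, Measurable fun x => L (f x) y) :
    Measurable fun w : X × Finset (Fin K) => isInLoss L I (f w.1) w.2 := by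
  refine measurable_from_prod_countable_left fun s => ?_
  simp only [isInLoss_eq_sum]
  exact Finset.measurable_sum _ fun y _ => (hL y).const_mul _

lemma integral_isInLoss (hI : 1 ≤ I) (hIK : I < K) (P : Measure (X × Fin K))
    [IsProbabilityMeasure P] {f : X → Score K} (hL : ∀ y, Measurable fun x => L (f x) y)
    {C : ℝ} (hC : ∀ x y, |L (f x) y| ≤ C) :
    ∫ w, isInLoss L I (f w.1) w.2 ∂(isInLaw P I) = risk P L f := by
  have := isProbabilityMeasure_questions hIK
  have hm := measurable_isInLoss (I := I) hL
  rw [isInLaw, integral_map measurable_isInLabel.aemeasurable hm.aestronglyMeasurable,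
    integral_prod]
  · simp only [integral_questions, ← loss_eq_sum hI hIK]
    rfl
  · refine Integrable.of_bound (hm.comp measurable_isInLabel).aestronglyMeasurable
      (∑ _y : Fin K, (1 + |1 + outWeight K I|) * C) (ae_of_all _ fun w => ?_)
    simp only [isInLoss_eq_sum]
    refine (norm_sum_le _ _).trans (Finset.sum_le_sum fun y _ => ?_)
    rw [norm_mul]
    refine mul_le_mul ?_ (hC _ _) (norm_nonneg _) (by positivity)
    refine (norm_sub_le _ _).trans ?_
    rw [norm_one, norm_mul]
    gcongr
    refine mul_le_of_le_one_right (norm_nonneg _) ?_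
    split_ifs <;> simp

/-- The range of the label loss for labels of an admissible size. -/
lemma isInLoss_mem_Icc (hI : 1 ≤ I) (hIK : I < K) {v : Score K} {C : ℝ}
    (h0 : ∀ y, 0 ≤ L v y) (hC : ∀ y, L v y ≤ C) {s : Finset (Fin K)}
    (hs : s.card = I ∨ s.card = K - I) :
    isInLoss L I v s ∈ Set.Icc (-(outWeight K I * (max (I : ℝ) (K - I) * C)))
      (max (I : ℝ) (K - I) * C) := by
  have hw := outWeight_nonneg hI hIK
  have hC0 : 0 ≤ C := (h0 ⟨0, by omega⟩).trans (hC ⟨0, by omega⟩)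
  have hc : ((K - I : ℕ) : ℝ) = K - I := Nat.cast_sub hIK.le
  have key : ∀ t : Finset (Fin K), (t.card = I ∨ t.card = K - I) →
      ∑ y ∈ t, L v y ≤ max (I : ℝ) (K - I) * C := by
    intro t ht
    refine (Finset.sum_le_card_nsmul _ _ _ fun y _ => hC y).trans ?_
    rw [nsmul_eq_mul]
    refine mul_le_mul_of_nonneg_right ?_ hC0
    rcases ht with h | h
    · rw [h]; exact le_max_left _ _
    · rw [h, hc]; exact le_max_right _ _
  have hs' : sᶜ.card = I ∨ sᶜ.card = K - I := by
    rw [Finset.card_compl, Fintype.card_fin]; omega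
  have n1 : 0 ≤ ∑ y ∈ s, L v y := Finset.sum_nonneg fun y _ => h0 y
  have n2 : 0 ≤ ∑ y ∈ sᶜ, L v y := Finset.sum_nonneg fun y _ => h0 y
  rw [isInLoss_eq]
  constructor
  · have := mul_le_mul_of_nonneg_left (key _ hs') hw
    linarith
  · have := mul_nonneg hw n2
    linarith [key _ hs]

lemma isInLoss_range (hI : 1 ≤ I) (hIK : I < K) (C : ℝ) :
    max (I : ℝ) (K - I) * C - -(outWeight K I * (max (I : ℝ) (K - I) * C)) =
      K * (K - 1) / (2 * min (I : ℝ) (K - I)) * C := by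
  have h1 : (0 : ℝ) < I := by exact_mod_cast hI
  have h2 : (0 : ℝ) < (K : ℝ) - I := sub_pos.2 (by exact_mod_cast hIK)
  -- The range has length `(1 + outWeight) * max * C`; the factor `max` cancels and leaves `min` in
  -- the denominator.
  have h3 : (I : ℝ) * (K - I) = max (I : ℝ) (K - I) * min (I : ℝ) (K - I) := (max_mul_min _ _).symm
  have h4 : 0 < max (I : ℝ) (K - I) := lt_max_of_lt_left h1
  have h5 : 0 < min (I : ℝ) (K - I) := lt_min h1 h2
  have h6 : max (I : ℝ) (K - I) * C - -(outWeight K I * (max (I : ℝ) (K - I) * C)) =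
    (1 + outWeight K I) * (max (I : ℝ) (K - I) * C) := by ring
  rw [h6, one_add_outWeight hI hIK, mul_assoc, h3]
  field_simp

end Labels

/-! ### From the loss class to the component classes -/

section Complexity

variable {Z : Type*}

/-- The Rademacher average of the class `H` on the points `z`. -/
noncomputable def rademacherAt (H : Set (Z → ℝ)) {n : ℕ} (z : Fin n → Z) : ℝ≥0∞ :=
  (∑ σ : Fin n → Bool, ⨆ h ∈ H,
      (((1 / (n : ℝ)) * ∑ i, sgn (σ i) * h (z i) : ℝ) : EReal)).toENNReal / 2 ^ n

lemma rademacher_eq_lintegral [MeasurableSpace Z] (μ : Measure Z) (n : ℕ) (H : Set (Z → ℝ)) :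
    rademacher μ n H = ∫⁻ z, rademacherAt H z ∂(Measure.pi fun _ : Fin n => μ) := rfl

lemma MeasurableClass.measurable_rademacherAt [MeasurableSpace Z] {H : Set (Z → ℝ)}
    (hH : MeasurableClass H) (n : ℕ) : Measurable (rademacherAt H (n := n)) := by
  refine Measurable.div_const (measurable_ereal_toENNReal.comp ?_) _
  refine Finset.measurable_sum _ fun σ _ => ?_
  have := hH n (fun i => (1 / (n : ℝ)) * sgn (σ i))
  simpa only [Finset.mul_sum, mul_assoc] using this

lemma coe_finsetSum_ereal {ι : Type*} (s : Finset ι) (u : ι → ℝ) :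
    ((∑ i ∈ s, u i : ℝ) : EReal) = ∑ i ∈ s, (u i : EReal) := by
  classical
  induction s using Finset.induction_on with
  | empty => simp
  | insert a s ha ih => rw [Finset.sum_insert ha, Finset.sum_insert ha, EReal.coe_add, ih]

lemma card_signs (n : ℕ) : (Fintype.card (Fin n → Bool) : ℝ) = 2 ^ n := by simp

/-- A finite family in `H` has a Rademacher average at most that of `H`. -/
lemma ofReal_expect_iSup_le_rademacherAt {H : Set (Z → ℝ)} {n : ℕ} (z : Fin n → Z)
    {α : Type*} [Finite α] [Nonempty α] (u : α → Z → ℝ) (hu : ∀ a, u a ∈ H) :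
    ENNReal.ofReal (𝔼 σ : Fin n → Bool, ⨆ a, ∑ i, sgn (σ i) * ((1 / (n : ℝ)) * u a (z i))) ≤
      rademacherAt H z := by
  rw [Fintype.expect_eq_sum_div_card, card_signs, ENNReal.ofReal_div_of_pos (by positivity),
    ENNReal.ofReal_pow zero_le_two, ENNReal.ofReal_ofNat, rademacherAt]
  refine ENNReal.div_le_div_right ?_ _
  rw [← EReal.real_coe_toENNReal, coe_finsetSum_ereal]
  refine EReal.toENNReal_le_toENNReal (Finset.sum_le_sum fun σ _ => ?_)
  obtain ⟨a, ha⟩ := exists_eq_ciSup_of_finite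
    (f := fun a => ∑ i, sgn (σ i) * ((1 / (n : ℝ)) * u a (z i)))
  rw [← ha]
  have e : ∑ i, sgn (σ i) * ((1 / (n : ℝ)) * u a (z i)) =
      (1 / (n : ℝ)) * ∑ i, sgn (σ i) * u a (z i) := by
    rw [Finset.mul_sum]; exact Finset.sum_congr rfl fun i _ => by ring
  rw [e]
  exact le_iSup₂ (f := fun h (_ : h ∈ H) =>
    (((1 / (n : ℝ)) * ∑ i, sgn (σ i) * h (z i) : ℝ) : EReal)) (u a) (hu a)

lemma norm_le_sum_abs {K : ℕ} (v : Score K) : ‖v‖ ≤ ∑ y, |v y| := by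
  rw [EuclideanSpace.norm_eq, Real.sqrt_le_iff]
  refine ⟨Finset.sum_nonneg fun _ _ => abs_nonneg _, ?_⟩
  exact Finset.sum_sq_le_sq_sum_of_nonneg fun _ _ => norm_nonneg _

variable {X : Type u} {K I : ℕ} {L : Score K → Fin K → ℝ} {F : Set (X → Score K)} {ρ : ℝ≥0}

/-- Vector contraction: the Rademacher average of the loss class is controlled by those of the
classes of discriminant functions. -/
lemma ofReal_expect_classSup_le (hF : F.Nonempty) (s : Set (Finset (Fin K)))
    (hρ : ∀ t ∈ s, LipschitzOnWith ρ (fun v => isInLoss L I v t) (attained F))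
    {n : ℕ} {z : Fin n → X × Finset (Fin K)} (hz : ∀ i, (z i).2 ∈ s) :
    ENNReal.ofReal (𝔼 σ : Fin n → Bool,
      classSup (lossClass L I F) (fun i => 1 / (n : ℝ) * sgn (σ i)) z) ≤
      ENNReal.ofReal (ρ * K) * ∑ y, rademacherAt (discClass F y) (fun i => (z i).1) := by
  have hne : (lossClass L I F).Nonempty := by
    obtain ⟨f, hf⟩ := hF
    exact ⟨_, f, hf, rfl⟩
  refine ENNReal.le_of_forall_pos_le_add fun ε hε _ => ?_
  -- One `ε`-maximizer is chosen per sign pattern. These finitely many hypotheses, indexed by the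
  -- patterns, form the finite class required for contraction.
  have hex : ∀ σ : Fin n → Bool, ∃ f ∈ F,
      classSup (lossClass L I F) (fun i => 1 / (n : ℝ) * sgn (σ i)) z - ε <
        ∑ i, 1 / (n : ℝ) * sgn (σ i) * isInLoss L I (f (z i).1) (z i).2 := by
    intro σ
    by_contra! hcon
    have := classSup_le hne (a := fun i => 1 / (n : ℝ) * sgn (σ i)) (z := z)
      (b := classSup (lossClass L I F) (fun i => 1 / (n : ℝ) * sgn (σ i)) z - ε) (by
        rintro _ ⟨f, hf, rfl⟩
        exact hcon f hf)
    have hε' : (0 : ℝ) < ε := hε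
    linarith
  choose f hfF hf using hex
  set h : Fin n → (Fin n → Bool) → ℝ :=
    fun i a => 1 / (n : ℝ) * isInLoss L I (f a (z i).1) (z i).2 with hh
  set g : Fin n → (Fin n → Bool) → Fin K → ℝ := fun i a y => 1 / (n : ℝ) * f a (z i).1 y with hg
  have hn : (0 : ℝ) ≤ 1 / n := by positivity
  have hcontr := expect_iSup_le_sum_expect_iSup h g ρ.coe_nonneg (by
    intro i a b
    have h1 := (hρ _ (hz i)).dist_le_mul (f a (z i).1) ⟨_, hfF a, _, rfl⟩
      (f b (z i).1) ⟨_, hfF b, _, rfl⟩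
    rw [Real.dist_eq, dist_eq_norm] at h1
    have h2 := h1.trans (mul_le_mul_of_nonneg_left (norm_le_sum_abs _) ρ.coe_nonneg)
    simp only [hh, hg, ← mul_sub, abs_mul, abs_of_nonneg hn, ← Finset.mul_sum]
    rw [mul_left_comm]
    exact mul_le_mul_of_nonneg_left h2 hn)
  have hle : (𝔼 σ : Fin n → Bool,
      classSup (lossClass L I F) (fun i => 1 / (n : ℝ) * sgn (σ i)) z) ≤
      ρ * K * ∑ y, (𝔼 σ : Fin n → Bool, ⨆ a, (∑ i, sgn (σ i) * g i a y)) + ε := by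
    have h3 : (𝔼 σ : Fin n → Bool,
        classSup (lossClass L I F) (fun i => 1 / (n : ℝ) * sgn (σ i)) z) ≤
        𝔼 σ : Fin n → Bool, ((⨆ a, (∑ i, sgn (σ i) * h i a)) + ε) := by
      refine Finset.expect_le_expect fun σ _ => ?_
      have h4 : ∑ i, sgn (σ i) * h i σ ≤ ⨆ a, (∑ i, sgn (σ i) * h i a) :=
        le_ciSup (Set.Finite.bddAbove (Set.finite_range fun a => ∑ i, sgn (σ i) * h i a)) σ
      have h5 : ∑ i, sgn (σ i) * h i σ =
          ∑ i, 1 / (n : ℝ) * sgn (σ i) * isInLoss L I (f σ (z i).1) (z i).2 :=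
        Finset.sum_congr rfl fun i _ => by rw [hh]; ring
      linarith [hf σ]
    rw [Finset.expect_add_distrib, Fintype.expect_const] at h3
    rw [Fintype.card_fin] at hcontr
    linarith
  refine (ENNReal.ofReal_le_ofReal hle).trans (ENNReal.ofReal_add_le.trans ?_)
  rw [ENNReal.ofReal_coe_nnreal, ENNReal.ofReal_mul (by positivity)]
  gcongr
  refine (Finset.le_sum_of_subadditive ENNReal.ofReal ENNReal.ofReal_zero.le
    (fun _ _ => ENNReal.ofReal_add_le) _ _).trans (Finset.sum_le_sum fun y _ => ?_)
  exact ofReal_expect_iSup_le_rademacherAt (fun i => (z i).1) (fun a x => f a x y)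
    fun a => ⟨f a, hfF a, rfl⟩

lemma ofReal_integral_le_lintegral_ofReal {Ω : Type*} [MeasurableSpace Ω] {μ : Measure Ω}
    {u : Ω → ℝ} (hu : Integrable u μ) :
    ENNReal.ofReal (∫ x, u x ∂μ) ≤ ∫⁻ x, ENNReal.ofReal (u x) ∂μ := by
  have h1 := ofReal_integral_eq_lintegral_ofReal hu.pos_part
    (ae_of_all _ fun x => le_max_right (u x) 0)
  have h2 : ∀ x, ENNReal.ofReal (max (u x) 0) = ENNReal.ofReal (u x) := fun x => by simp
  simp only [h2] at h1
  rw [← h1]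
  exact ENNReal.ofReal_le_ofReal (integral_mono hu hu.pos_part fun x => le_max_left _ _)

variable [MeasurableSpace X]

lemma ofReal_rademacherReal_lossClass_le (hIK : I < K) (P : Measure (X × Fin K))
    [IsProbabilityMeasure P] (hF : F.Nonempty)
    (hH : MeasurableClass (lossClass L I F)) (hGc : ∀ y, MeasurableClass (discClass F y))
    {lo hi : ℝ}
    (hb : BoundedOn (lossClass L I F) {w | w.2.card = I ∨ w.2.card = K - I} lo hi)
    (hρ : ∀ s : Finset (Fin K), s.card = I ∨ s.card = K - I →
      LipschitzOnWith ρ (fun v => isInLoss L I v s) (attained F)) (n : ℕ) :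
    ENNReal.ofReal (rademacherReal (isInLaw P I) n (lossClass L I F)) ≤
      ENNReal.ofReal (ρ * K) * ∑ y, rademacher P.fst n (discClass F y) := by
  have := isProbabilityMeasure_isInLaw hIK P
  have hne : (lossClass L I F).Nonempty := by
    obtain ⟨f, hf⟩ := hF
    exact ⟨_, f, hf, rfl⟩
  have hG := ae_isInLaw hIK P
  have hmp : MeasurePreserving (fun (z : Fin n → X × Finset (Fin K)) i => (z i).1)
      (Measure.pi fun _ => isInLaw P I) (Measure.pi fun _ => P.fst) :=
    measurePreserving_pi _ _ fun _ => measurePreserving_fst_isInLaw hIK P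
  have hint : Integrable (fun z => 𝔼 σ : Fin n → Bool,
      classSup (lossClass L I F) (fun i => 1 / (n : ℝ) * sgn (σ i)) z)
      (Measure.pi fun _ : Fin n => isInLaw P I) := by
    simp only [Fintype.expect_eq_sum_div_card]
    exact (integrable_finsetSum _ fun σ _ => integrable_classSup hne hH hG hb _).div_const _
  refine (ofReal_integral_le_lintegral_ofReal hint).trans ?_
  refine (lintegral_mono_ae ((ae_pi_mem hG n).mono fun z hz =>
    ofReal_expect_classSup_le hF {t | t.card = I ∨ t.card = K - I} hρ hz)).trans (le_of_eq ?_)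
  have hm : ∀ y, Measurable fun z : Fin n → X × Finset (Fin K) =>
      rademacherAt (discClass F y) (fun i => (z i).1) := fun y =>
    ((hGc y).measurable_rademacherAt n).comp hmp.measurable
  rw [lintegral_const_mul _ (Finset.measurable_sum _ fun y _ => hm y),
    lintegral_finsetSum _ fun y _ => hm y]
  congr 1
  refine Finset.sum_congr rfl fun y _ => ?_
  rw [rademacher_eq_lintegral]
  exact hmp.lintegral_comp ((hGc y).measurable_rademacherAt n)

end Complexity

/-! ### Complexity of the linear-in-parameter model -/

section KernelComplexity

variable {X : Type u} {H : Type v} [NormedAddCommGroup H] [InnerProductSpace ℝ H]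

/-- Averaging over the sign of `v 0` removes the cross term with the remaining sum. -/
lemma expect_norm_sum_sq {n : ℕ} (v : Fin n → H) :
    𝔼 σ : Fin n → Bool, ‖∑ i, sgn (σ i) • v i‖ ^ 2 = ∑ i, ‖v i‖ ^ 2 := by
  induction n with
  | zero => simp
  | succ n ih =>
    rw [expect_cons, Finset.expect_comm, Fin.sum_univ_succ, ← ih (fun i => v i.succ),
      ← Fintype.expect_const (ι := Fin n → Bool) (‖v 0‖ ^ 2), ← Finset.expect_add_distrib]
    refine Finset.expect_congr rfl fun σ _ => ?_
    rw [Fintype.expect_eq_sum_div_card]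
    simp only [Fin.sum_univ_succ, Fin.cons_zero, Fin.cons_succ, Fintype.univ_bool,
      Finset.sum_insert, Finset.mem_singleton, Bool.true_eq_false, not_false_eq_true,
      Finset.sum_singleton, Fintype.card_bool, sgn, if_true, Bool.false_eq_true, if_false,
      one_smul, neg_smul]
    have h1 := norm_add_sq_real (v 0) (∑ i : Fin n, (if σ i then (1 : ℝ) else -1) • v i.succ)
    have h2 := norm_add_sq_real (-v 0) (∑ i : Fin n, (if σ i then (1 : ℝ) else -1) • v i.succ)
    rw [inner_neg_left, norm_neg] at h2
    rw [h1, h2]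
    push_cast
    ring

lemma expect_norm_sum_le {n : ℕ} {v : Fin n → H} {M : ℝ} (hM : 0 ≤ M) (hv : ∀ i, ‖v i‖ ≤ M) :
    𝔼 σ : Fin n → Bool, ‖∑ i, sgn (σ i) • v i‖ ≤ √n * M := by
  have h1 : (𝔼 σ : Fin n → Bool, ‖∑ i, sgn (σ i) • v i‖) ^ 2 ≤ n * M ^ 2 := by
    have hj : (𝔼 σ : Fin n → Bool, ‖∑ i, sgn (σ i) • v i‖) ^ 2 ≤
        𝔼 σ : Fin n → Bool, ‖∑ i, sgn (σ i) • v i‖ ^ 2 := by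
      rw [Fintype.expect_eq_sum_div_card, Fintype.expect_eq_sum_div_card]
      exact sum_div_card_sq_le_sum_sq_div_card
    rw [expect_norm_sum_sq] at hj
    refine hj.trans ((Finset.sum_le_card_nsmul _ _ (M ^ 2) fun i _ => ?_).trans (by simp))
    exact pow_le_pow_left₀ (norm_nonneg _) (hv i) 2
  refine le_of_sq_le_sq ?_ (by positivity)
  rw [mul_pow, Real.sq_sqrt (by positivity)]
  exact h1

lemma rademacherAt_kernelModel_le {K n : ℕ} {Φ : X → H} {Λ M : ℝ} (hM : 0 ≤ M)
    (hΛ : 0 ≤ Λ) (hΦ : ∀ x, ‖Φ x‖ ≤ M) (y : Fin K) (x : Fin n → X) :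
    rademacherAt (discClass (kernelModel K Φ Λ) y) x ≤ ENNReal.ofReal (Λ * M / √n) := by
  have h1 : (∑ σ : Fin n → Bool, ⨆ h ∈ discClass (kernelModel K Φ Λ) y,
      (((1 / (n : ℝ)) * ∑ i, sgn (σ i) * h (x i) : ℝ) : EReal)) ≤
      ((∑ σ : Fin n → Bool, (1 / (n : ℝ)) * (Λ * ‖∑ i, sgn (σ i) • Φ (x i)‖) : ℝ) : EReal) := by
    rw [coe_finsetSum_ereal]
    refine Finset.sum_le_sum fun σ _ => iSup₂_le ?_
    rintro _ ⟨f, hf, rfl⟩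
    obtain ⟨w, hw, hfw⟩ := hf y
    refine EReal.coe_le_coe_iff.2 (mul_le_mul_of_nonneg_left ?_ (by positivity))
    have e : ∑ i, sgn (σ i) * f (x i) y = inner ℝ w (∑ i, sgn (σ i) • Φ (x i)) := by
      simp [inner_sum, inner_smul_right, hfw]
    rw [e]
    exact (real_inner_le_norm _ _).trans (mul_le_mul_of_nonneg_right hw (norm_nonneg _))
  rw [rademacherAt]
  refine (ENNReal.div_le_div_right (EReal.toENNReal_le_toENNReal h1) _).trans ?_
  rw [EReal.real_coe_toENNReal, show (2 : ℝ≥0∞) ^ n = ENNReal.ofReal (2 ^ n) by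
    rw [ENNReal.ofReal_pow zero_le_two, ENNReal.ofReal_ofNat],
    ← ENNReal.ofReal_div_of_pos (by positivity)]
  refine ENNReal.ofReal_le_ofReal ?_
  rw [← card_signs, ← Fintype.expect_eq_sum_div_card, ← Finset.mul_expect, ← Finset.mul_expect]
  have h2 := expect_norm_sum_le hM fun i => hΦ (x i)
  calc 1 / (n : ℝ) * (Λ * 𝔼 σ : Fin n → Bool, ‖∑ i, sgn (σ i) • Φ (x i)‖)
      ≤ 1 / (n : ℝ) * (Λ * (√n * M)) := by gcongr
    _ = Λ * M * (√n / n) := by ring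
    _ = Λ * M / √n := by rw [Real.sqrt_div_self]; ring

lemma tendsto_rademacher_kernelModel [MeasurableSpace X] (μ : Measure X) [IsProbabilityMeasure μ]
    {K : ℕ} {Φ : X → H} {Λ : ℝ} (hΛ : 0 ≤ Λ)
    (hΦ : BddAbove (Set.range fun x => inner ℝ (Φ x) (Φ x))) (y : Fin K) :
    Tendsto (fun n => rademacher μ n (discClass (kernelModel K Φ Λ) y)) atTop (𝓝 0) := by
  obtain ⟨B, hB⟩ := hΦ
  have hM : ∀ x, ‖Φ x‖ ≤ √B := fun x => by
    refine Real.le_sqrt_of_sq_le ?_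
    rw [← real_inner_self_eq_norm_sq]
    exact hB ⟨x, rfl⟩
  have hle : ∀ n, rademacher μ n (discClass (kernelModel K Φ Λ) y) ≤
      ENNReal.ofReal (Λ * √B / √(n : ℝ)) := by
    intro n
    rw [rademacher_eq_lintegral]
    refine (lintegral_mono fun x =>
      rademacherAt_kernelModel_le (Real.sqrt_nonneg B) hΛ hM y x).trans ?_
    simp
  refine tendsto_of_tendsto_of_tendsto_of_le_of_le tendsto_const_nhds ?_ (fun _ => zero_le) hle
  rw [← ENNReal.ofReal_zero]
  refine ENNReal.tendsto_ofReal ?_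
  exact tendsto_const_nhds.div_atTop (Real.tendsto_sqrt_atTop.comp tendsto_natCast_atTop_atTop)

end KernelComplexity

/-! ### Excess risk bound, optimal number of items, consistency -/

section ExcessRisk

variable {K I : ℕ}

lemma two_mul_le_coefficient (hI : 1 ≤ I) (hIK : I < K) (ρ : ℝ≥0) :
    2 * (ρ * K) ≤ √2 * ρ * (K : ℝ) ^ 2 * (K - 1) / (I * (K - I)) := by
  have h1 : (1 : ℝ) ≤ I := by exact_mod_cast hI
  have h2 : (I : ℝ) + 1 ≤ K := by exact_mod_cast hIK
  have h3 : 0 < (I : ℝ) * (K - I) := mul_pos (by linarith) (by linarith)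
  have h4 : (1 : ℝ) ≤ √2 := Real.one_le_sqrt.2 one_le_two
  -- By AM-GM the coefficient is at least `4√2 ρ (K-1)`, and `K ≥ 2` makes this at least `2ρK`.
  have h5 : (I : ℝ) * (K - I) ≤ (K : ℝ) ^ 2 / 4 := by nlinarith [sq_nonneg ((K : ℝ) - 2 * I)]
  have h6 : (0 : ℝ) ≤ ρ * K := by positivity
  rw [le_div_iff₀ h3]
  have h7 : 2 * (ρ * K) * ((I : ℝ) * (K - I)) ≤ 2 * (ρ * K) * ((K : ℝ) ^ 2 / 4) := by gcongr
  have h8 : (K : ℝ) * K / 2 ≤ 1 * (K * (K - 1)) := by nlinarith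
  have h9 : 1 * ((K : ℝ) * (K - 1)) ≤ √2 * (K * (K - 1)) :=
    mul_le_mul_of_nonneg_right h4 (mul_nonneg (by linarith) (by linarith))
  have h10 := mul_le_mul_of_nonneg_left (h8.trans h9) h6
  linarith

variable {X : Type u} [MeasurableSpace X] {P : Measure (X × Fin K)} [IsProbabilityMeasure P]
  {L : Score K → Fin K → ℝ} {F : Set (X → Score K)} {C : ℝ} {ρ : ℝ≥0} {fstar : X → Score K}

/-- The excess risk bound for minimizers of the empirical risk. -/
theorem measure_erm_excess_lt (hI : 1 ≤ I) (hIK : I < K)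
    (hFmeas : ∀ f ∈ F, Measurable f)
    (hLclass : MeasurableClass (lossClass L I F))
    (hGclass : ∀ y, MeasurableClass (discClass F y))
    (hLnonneg : ∀ v ∈ attained F, ∀ y, 0 ≤ L v y)
    (hLC : ∀ v ∈ attained F, ∀ y, L v y ≤ C) (hC0 : 0 ≤ C)
    (hρ : ∀ s : Finset (Fin K), s.card = I ∨ s.card = K - I →
      LipschitzOnWith ρ (fun v => isInLoss L I v s) (attained F))
    (hfstar : fstar ∈ F) {n : ℕ} {δ : ℝ} (hn : 1 ≤ n) (hδ : 0 < δ) :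
    sampleLaw (isInLaw P I) n
        {S | ∃ fhat, IsERM L I F S fhat ∧
          ¬ ENNReal.ofReal (risk P L fhat - risk P L fstar) ≤
            excessBound K ρ C (∑ y, rademacher P.fst n (discClass F y)) n δ I}
        < ENNReal.ofReal δ := by
  have hprob := isProbabilityMeasure_isInLaw hIK P
  have hatt : ∀ f ∈ F, ∀ x, f x ∈ attained F := fun f hf x => ⟨f, hf, x, rfl⟩
  rcases lt_or_ge 1 δ with hδ1 | hδ1
  · have : IsProbabilityMeasure (sampleLaw (isInLaw P I) n) := by
      unfold sampleLaw; infer_instance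
    exact prob_le_one.trans_lt (ENNReal.one_lt_ofReal.2 hδ1)
  -- For `C = 0` the deviation term vanishes and the tail bound would only say `1`; but then all
  -- risks are `0`.
  rcases hC0.eq_or_lt with hC | hC
  · have hrisk : ∀ f ∈ F, risk P L f = 0 := by
      intro f hf
      have : ∀ p : X × Fin K, L (f p.1) p.2 = 0 := fun p =>
        le_antisymm ((hLC _ (hatt f hf p.1) _).trans hC.symm.le) (hLnonneg _ (hatt f hf p.1) _)
      simp [risk, this]
    refine lt_of_le_of_lt (le_of_eq ?_) (ENNReal.ofReal_pos.2 hδ)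
    rw [Set.eq_empty_of_forall_notMem (s := {S | _}) ?_, measure_empty]
    rintro S ⟨f, hf, hfail⟩
    exact hfail (by simp [hrisk f hf.1, hrisk fstar hfstar])
  set B : ℝ := K * (K - 1) / (2 * min (I : ℝ) (K - I)) * C with hB
  set lo : ℝ := -(outWeight K I * (max (I : ℝ) (K - I) * C)) with hlo
  set hi : ℝ := max (I : ℝ) (K - I) * C with hhi
  have hrange : hi - lo = B := isInLoss_range hI hIK C
  have hI' : (1 : ℝ) ≤ I := by exact_mod_cast hI
  have hK' : (I : ℝ) + 1 ≤ K := by exact_mod_cast hIK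
  have hBpos : 0 < B := by
    have h1 : 0 < min (I : ℝ) (K - I) := lt_min (by linarith) (by linarith)
    have h2 : (0 : ℝ) < K * (K - 1) := mul_pos (by linarith) (by linarith)
    positivity
  have hb : BoundedOn (lossClass L I F)
      {w : X × Finset (Fin K) | w.2.card = I ∨ w.2.card = K - I} lo hi := by
    rintro _ ⟨f, hf, rfl⟩ w hw
    exact isInLoss_mem_Icc hI hIK (hLnonneg _ (hatt f hf _)) (hLC _ (hatt f hf _)) hw
  have hLm : ∀ f ∈ F, ∀ y, Measurable fun x => L (f x) y := fun f hf =>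
    measurable_loss hI hIK hρ (hFmeas f hf) (hatt f hf)
  have hrisk : ∀ f ∈ F, ∫ w, isInLoss L I (f w.1) w.2 ∂(isInLaw P I) = risk P L f := fun f hf =>
    integral_isInLoss hI hIK P (hLm f hf) (C := C) fun x y => by
      rw [abs_of_nonneg (hLnonneg _ (hatt f hf x) y)]
      exact hLC _ (hatt f hf x) y
  -- With this deviation the tail exponent is `-log (2 / δ)`, so the failure probability is at most
  -- `δ/2`.
  set b : ℝ := B * √(2 * Real.log (2 / δ) / n) with hbdef
  have hbound : ENNReal.ofReal (2 * rademacherReal (isInLaw P I) n (lossClass L I F) + b) ≤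
      excessBound K ρ C (∑ y, rademacher P.fst n (discClass F y)) n δ I := by
    refine ENNReal.ofReal_add_le.trans (add_le_add ?_ le_rfl)
    rw [ENNReal.ofReal_mul zero_le_two]
    refine (mul_le_mul_right (ofReal_rademacherReal_lossClass_le hIK P ⟨fstar, hfstar⟩ hLclass
      hGclass hb hρ n) _).trans ?_
    rw [← mul_assoc, ← ENNReal.ofReal_mul zero_le_two]
    exact mul_le_mul_left (ENNReal.ofReal_le_ofReal (two_mul_le_coefficient hI hIK ρ)) _
  have hmain := measure_exists_excess_le (μ := isInLaw P I) hLclass (ae_isInLaw hIK P) hb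
    (by
      rintro _ ⟨f, hf, rfl⟩
      exact ⟨_, measurable_isInLoss (hLm f hf), fun _ _ => rfl⟩)
    (n := n) (by omega) ⟨fstar, hfstar, rfl⟩ (t := b) (by positivity)
  refine (measure_mono ?_).trans_lt (hmain.trans_lt ?_)
  · rintro S ⟨f, ⟨hf, hmin⟩, hfail⟩
    refine ⟨_, ⟨f, hf, rfl⟩, hmin hfstar, ?_⟩
    rw [hrisk f hf, hrisk fstar hfstar]
    by_contra hcon
    exact hfail ((ENNReal.ofReal_le_ofReal (not_lt.1 hcon)).trans hbound)
  · rw [hrange, ENNReal.ofReal_lt_ofReal_iff hδ]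
    have hn' : (0 : ℝ) < n := by exact_mod_cast hn
    have hlog : 0 ≤ Real.log (2 / δ) := Real.log_nonneg (by rw [le_div_iff₀ hδ]; linarith)
    have e : -(n * b ^ 2 / (2 * B ^ 2)) = -Real.log (2 / δ) := by
      rw [hbdef, mul_pow, Real.sq_sqrt (by positivity)]
      field_simp
    rw [e, Real.exp_neg, Real.exp_log (by positivity), inv_div]
    linarith

lemma isMinOn_excessBound (hK : 2 ≤ K) (hC0 : 0 ≤ C) (rad : ℝ≥0∞) (n : ℕ) (δ : ℝ) :
    IsMinOn (excessBound K ρ C rad n δ) (Set.Ioo (0 : ℝ) K) (K / 2) := by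
  rintro t ⟨h0, h1⟩
  have hK' : (2 : ℝ) ≤ K := by exact_mod_cast hK
  have hK1 : (0 : ℝ) ≤ K - 1 := by linarith
  have e : (K : ℝ) - K / 2 = K / 2 := by ring
  have hpos : 0 < min t (K - t) := lt_min h0 (sub_pos.2 h1)
  have hmin : min t (K - t) ≤ K / 2 := by
    rcases le_total t (K / 2) with h | h
    · exact (min_le_left _ _).trans h
    · exact (min_le_right _ _).trans (by linarith)
  have hprod : t * (K - t) ≤ K / 2 * (K / 2) := by nlinarith [sq_nonneg ((K : ℝ) - 2 * t)]
  have hprod0 : 0 < t * (K - t) := mul_pos h0 (sub_pos.2 h1)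
  change excessBound K ρ C rad n δ (K / 2) ≤ excessBound K ρ C rad n δ t
  unfold excessBound
  rw [e, min_self]
  gcongr

omit [IsProbabilityMeasure P] in
/-- Consistency follows from excess risk bounds that tend to zero. -/
lemma consistent_of_tendsto (hbd : ∀ (n : ℕ) (δ : ℝ), 1 ≤ n → 0 < δ →
      sampleLaw (isInLaw P I) n
        {S | ∃ fhat, IsERM L I F S fhat ∧
          ¬ ENNReal.ofReal (risk P L fhat - risk P L fstar) ≤
            excessBound K ρ C (∑ y, rademacher P.fst n (discClass F y)) n δ I}
        < ENNReal.ofReal δ)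
    (hrad : ∀ y, Tendsto (fun n => rademacher P.fst n (discClass F y)) atTop (𝓝 0)) :
    Consistent P L I F fstar := by
  intro ε hε
  rw [ENNReal.tendsto_nhds_zero]
  intro η hη
  -- `δ` is fixed below the target probability; for this `δ` the bound falls below `ε` once `n` is
  -- large.
  obtain ⟨δ, hδ0, hδ⟩ : ∃ δ : ℝ, 0 < δ ∧ ENNReal.ofReal δ ≤ η := by
    obtain ⟨r, hr0, hr⟩ := ENNReal.lt_iff_exists_nnreal_btwn.1 hη
    exact ⟨r, by exact_mod_cast hr0, by rw [ENNReal.ofReal_coe_nnreal]; exact hr.le⟩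
  have hlim : Tendsto (fun n : ℕ => excessBound K ρ C
      (∑ y, rademacher P.fst n (discClass F y)) n δ I) atTop (𝓝 0) := by
    have h1 : Tendsto (fun n => ∑ y, rademacher P.fst n (discClass F y)) atTop (𝓝 0) := by
      simpa using tendsto_finsetSum Finset.univ fun y _ => hrad y
    have h2 : Tendsto (fun n : ℕ => √(2 * Real.log (2 / δ) / n)) atTop (𝓝 0) := by
      have := (tendsto_const_nhds (x := 2 * Real.log (2 / δ))).div_atTop
        (tendsto_natCast_atTop_atTop (R := ℝ))
      have h := (Real.continuous_sqrt.tendsto _).comp this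
      rwa [Real.sqrt_zero] at h
    have h3 := ENNReal.Tendsto.const_mul
      (a := ENNReal.ofReal (√2 * ρ * (K : ℝ) ^ 2 * (K - 1) / (I * (K - I)))) h1
      (Or.inr ENNReal.ofReal_ne_top)
    have h4 := ENNReal.tendsto_ofReal
      (h2.const_mul (K * (K - 1) / (2 * min (I : ℝ) (K - I)) * C))
    simpa [excessBound] using h3.add h4
  filter_upwards [(ENNReal.tendsto_nhds_zero.1 hlim) (ENNReal.ofReal ε) (ENNReal.ofReal_pos.2 hε),
    eventually_ge_atTop 1] with n hn hn1
  refine (measure_mono ?_).trans ((hbd n δ hn1 hδ0).le.trans hδ)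
  rintro S ⟨f, hf, hlt⟩
  refine ⟨f, hf, fun hle => ?_⟩
  exact absurd (hle.trans hn) (not_le.2 ((ENNReal.ofReal_lt_ofReal_iff_of_nonneg hε.le).2 hlt))

end ExcessRisk

end QALabel

theorem theorem6 {X : Type u} [MeasurableSpace X] {K I : ℕ} (hI : 1 ≤ I) (hIK : I < K)
    (P : Measure (X × Fin K)) [IsProbabilityMeasure P]
    (L : QALabel.Score K → Fin K → ℝ)
    (F : Set (X → QALabel.Score K))
    (hFmeas : ∀ f ∈ F, Measurable f)
    (hLclass : QALabel.MeasurableClass (QALabel.lossClass L I F))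
    (hGclass : ∀ y, QALabel.MeasurableClass (QALabel.discClass F y))
    (hLnonneg : ∀ v ∈ QALabel.attained F, ∀ y, 0 ≤ L v y)
    (C : ℝ) (hC : IsLUB {r : ℝ | ∃ v ∈ QALabel.attained F, ∃ y, r = L v y} C)
    (ρ : ℝ≥0)
    (hρ : ∀ s : Finset (Fin K), s.card = I ∨ s.card = K - I →
      LipschitzOnWith ρ (fun v => QALabel.isInLoss L I v s) (QALabel.attained F))
    (fstar : X → QALabel.Score K) (hfstar : fstar ∈ F)
    (hfmin : IsMinOn (QALabel.risk P L) F fstar) :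
    (∀ (n : ℕ) (δ : ℝ), 1 ≤ n → 0 < δ →
      QALabel.sampleLaw (QALabel.isInLaw P I) n
        {S | ∃ fhat, QALabel.IsERM L I F S fhat ∧
          ¬ ENNReal.ofReal (QALabel.risk P L fhat - QALabel.risk P L fstar) ≤
            QALabel.excessBound K ρ C
              (∑ y, QALabel.rademacher P.fst n (QALabel.discClass F y)) n δ I}
        < ENNReal.ofReal δ) ∧
    (∀ (n : ℕ) (δ : ℝ), 1 ≤ n → 0 < δ →
      IsMinOn
        (QALabel.excessBound K ρ C
          (∑ y, QALabel.rademacher P.fst n (QALabel.discClass F y)) n δ)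
        (Set.Ioo (0 : ℝ) K) (K / 2)) ∧
    ((∀ y, Tendsto (fun n => QALabel.rademacher P.fst n (QALabel.discClass F y)) atTop (𝓝 0)) →
      QALabel.Consistent P L I F fstar) ∧
    (∀ (H : Type v) [NormedAddCommGroup H] [InnerProductSpace ℝ H] [CompleteSpace H]
      (Φ : X → H) (Λ : ℝ), 0 ≤ Λ →
      BddAbove (Set.range fun x => inner ℝ (Φ x) (Φ x)) →
      F = QALabel.kernelModel K Φ Λ →
      QALabel.Consistent P L I F fstar) := by
  have hLC : ∀ v ∈ QALabel.attained F, ∀ y, L v y ≤ C := fun v hv y => hC.1 ⟨v, hv, y, rfl⟩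
  -- A probability measure needs a point, so some score vector is attained and its nonnegative loss
  -- lies below `C`.
  have hC0 : 0 ≤ C := by
    obtain ⟨p⟩ := nonempty_of_isProbabilityMeasure P
    have hv : fstar p.1 ∈ QALabel.attained F := ⟨fstar, hfstar, p.1, rfl⟩
    exact (hLnonneg _ hv p.2).trans (hLC _ hv p.2)
  have hbd := fun (n : ℕ) (δ : ℝ) (hn : 1 ≤ n) (hδ : 0 < δ) =>
    QALabel.measure_erm_excess_lt (P := P) hI hIK hFmeas hLclass hGclass hLnonneg hLC hC0 hρ
      hfstar hn hδ
  refine ⟨hbd, fun n δ _ _ => QALabel.isMinOn_excessBound (by omega) hC0 _ n δ,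
    QALabel.consistent_of_tendsto hbd, ?_⟩
  intro H _ _ _ Φ Λ hΛ hΦ hF
  refine QALabel.consistent_of_tendsto hbd fun y => ?_
  rw [hF]
  exact QALabel.tendsto_rademacher_kernelModel P.fst hΛ hΦ y
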